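/- There is a universal constant $c>0$ such that the following holds. **Setting.** Let $\mathcal S,\mathcal A$ be countable (finite or infinite) state and action spaces. The real environment and the simulator share the reward law $R:\mathcal S\times\mathcal A\to\Delta([0,R_{\max}])$, the discount factor $\gamma\in[0,1)$ and the initial distribution $d_0$, and have transition functions $P_{te}$ and $P_{tr}$, respectively. Let $\pi$ be a policy and write $f(s,\pi)=\mathbb E_{a\sim\pi(\cdot|s)}[f(s,a)]$. For dynamics $P$ put $$J_P(\pi)=(1-\gamma)\,\mathbb E\Big[\sum_{t\ge0}\gamma^t r_t\,\Big|\,\pi,d_0\Big],\qquad d^\pi_P(s,a)=(1-\gamma)\sum_{t\ge0}\gamma^t\,\mathbb P[s_t=s,a_t=a\mid\pi,d_0],$$ and let $Q^\pi_P(s,a)=\mathbb E[\sum_{t\ge 0}\gamma^t r_t\mid s_0=s,a_0=a,\pi]$. Let $\mu$ be a probability distribution on $\mathcal S\times\mathcal A$ such that $d^\pi_{P_{tr}}(s,a)=0$ whenever $\mu(s,a)=0$, and put $\beta=d^\pi_{P_{tr}}/\mu$ (with $\beta=0$ where $\mu=0$) and $\|d^\pi_{P_{tr}}/\mu\|_\infty=\sup_{s,a}\beta(s,a)$.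 For functions $w,b,q$ on $\mathcal S\times\mathcal A$ let $$L_w(w,b,q)=\Big|\mathbb E_{(s,a)\sim\mu,\,s'\sim P_{te}(s,a)}\big[w(s,a)\,b(s,a)\,(q(s,a)-\gamma q(s',\pi))\big]-(1-\gamma)\,\mathbb E_{s\sim d_0}[q(s,\pi)]\Big|,$$ and let $L_{n,w}(w,b,q)$ be the same quantity with the expectation over $(s,a,s')$ replaced by the average over a sample $z_1,\dots,z_n$. **Assumptions.** Let $\mathcal F,\mathcal W,\mathcal Q$ be classes of functions on $\mathcal S\times\mathcal A$ with $0<C_{\mathcal F,\min}\le f\le C_{\mathcal F,\max}$ for $f\in\mathcal F$, $0\le w\le C_{\mathcal W}$ for $w\in\mathcal W$ and $0\le q\le C_{\mathcal Q}$ for $q\in\mathcal Q$; put $C_{\mathcal F}=C_{\mathcal F,\max}+\max(\log C_{\mathcal F,\max},-\log C_{\mathcal F,\min})$. Assume that $\beta\in\mathcal F$ (that is, some $f\in\mathcal F$ equals $\beta$ wherever $\mu>0$) and that $Q^\pi_{P_{te}}$ lies in the convex hull of $\mathcal Q$. **Estimator.** Let $n\ge1$ and $\delta\in(0,1)$. Let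 $x_1,\dots,x_n\sim d^\pi_{P_{tr}}$ (from the simulator) and $y_1,\dots,y_n\sim\mu$ be i.i.d. and independent of each other, and let $z_1,\dots,z_n$ be i.i.d. triples $(s,a,s')$ with $(s,a)\sim\mu$, $s'\sim P_{te}(s,a)$; the $z_i$ may depend arbitrarily on the $x_i,y_i$ (for instance, they may share the pairs $(s,a)$ with the $y_i$). Almost surely, let $$\hat\beta\in\arg\max_{f\in\mathcal F}\ \frac1n\sum_{i=1}^n\log f(x_i)-\frac1n\sum_{i=1}^n f(y_i),\qquad \hat w_n\in\arg\min_{w\in\mathcal W}\ \sup_{q\in\mathcal Q}L_{n,w}(w,\hat\beta,q).$$ **Conclusion.** With probability at least $1-\delta$, $$\begin{aligned}\Big|\mathbb E_{(s,a)\sim d^\pi_{P_{tr}},\,r\sim R(s,a)}[\hat w_n(s,a)\,r]-J_{P_{te}}(\pi)\Big|\le{}&\inf_{w\in\mathcal W}\sup_{q\in\mathcal Q}L_w(w,\beta,q)\\&+2\,C_{\mathcal W}C_{\mathcal Q}\cdot c\,\sqrt{\Big\|\frac{d^\pi_{P_{tr}}}{\mu}\Big\|_\infty\Big(4\mathcal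 R_n(\mathcal F)+C_{\mathcal F}\sqrt{\frac{2\log(2/\delta)}{n}}\Big)}\\&+2\,\mathcal R_n(\mathcal W,\mathcal Q)+C_{\mathcal Q}C_{\mathcal W}\sqrt{\frac{\log(2/\delta)}{2n}}.\end{aligned}$$ Here $\mathcal R_n(\mathcal F)$ is the Rademacher complexity of $\{(x,y)\mapsto f(x)-\log f(y):f\in\mathcal F\}$ under $\mu\otimes d^\pi_{P_{tr}}$, and $\mathcal R_n(\mathcal W,\mathcal Q)$ is that of $\{(s,a,s')\mapsto w(s,a)\beta(s,a)(q(s,a)-\gamma q(s',\pi)):w\in\mathcal W,q\in\mathcal Q\}$ under $(s,a)\sim\mu$, $s'\sim P_{te}(s,a)$, where the Rademacher complexity of a class $\mathcal G$ is $\mathbb E\sup_{g\in\mathcal G}\big|\frac2n\sum_{i=1}^n\varepsilon_i g(\xi_i)\big|$ for an i.i.d. sample $\xi_1,\dots,\xi_n$ and independent uniform signs $\varepsilon_i$. -/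

import Mathlib

open MeasureTheory ProbabilityTheory

noncomputable section

namespace OffEnv

variable {S A : Type*} [MeasurableSpace S] [MeasurableSpace A]

/-- Law of `(s_t, a_t)` in the chain with dynamics `P` and policy `π`, when `(s_0, a_0) ∼ ν`. -/
def stateActionLaw (P : Kernel (S × A) S) (π : Kernel S A) (ν : Measure (S × A)) :
    ℕ → Measure (S × A)
  | 0 => ν
  | t + 1 => (stateActionLaw P π ν t).bind P ⊗ₘ π

/-- Normalized discounted state-action occupancy
`d^π_P = (1 - γ) ∑_t γ^t Pr[(s_t, a_t) = ·]` with `s_0 ∼ d₀`, `a_0 ∼ π(· | s_0)`. -/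
def occupancy (P : Kernel (S × A) S) (π : Kernel S A) (d₀ : Measure S) (γ : ℝ) :
    Measure (S × A) :=
  Measure.sum fun t => ENNReal.ofReal ((1 - γ) * γ ^ t) • stateActionLaw P π (d₀ ⊗ₘ π) t

/-- Normalized expected discounted return `J_P(π) = (1 - γ) ∑_t γ^t E[r_t]`. -/
def performance (P : Kernel (S × A) S) (π : Kernel S A) (R : Kernel (S × A) ℝ)
    (d₀ : Measure S) (γ : ℝ) : ℝ :=
  (1 - γ) * ∑' t : ℕ, γ ^ t * ∫ x, (∫ r, r ∂(R x)) ∂(stateActionLaw P π (d₀ ⊗ₘ π) t)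

/-- The Q-function `Q^π_P(s, a) = ∑_t γ^t E[r_t | s_0 = s, a_0 = a]`. -/
def qFunction (P : Kernel (S × A) S) (π : Kernel S A) (R : Kernel (S × A) ℝ) (γ : ℝ)
    (x : S × A) : ℝ :=
  ∑' t : ℕ, γ ^ t * ∫ y, (∫ r, r ∂(R y)) ∂(stateActionLaw P π (Measure.dirac x) t)

/-- `f(s, π) = E_{a ∼ π(· | s)}[f(s, a)]`. -/
def policyValue (π : Kernel S A) (f : S × A → ℝ) (s : S) : ℝ :=
  ∫ a, f (s, a) ∂(π s)

/-- The ratio of probability masses `x ↦ p(x) / μ(x)`. -/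
def densityRatio {X : Type*} [MeasurableSpace X] (p μ : Measure X) (x : X) : ℝ :=
  p.real {x} / μ.real {x}

/-- The function `(s, a, s') ↦ w(s, a) b(s, a) (q(s, a) - γ q(s', π))`. -/
def weightedResidual (π : Kernel S A) (γ : ℝ) (w b q : S × A → ℝ) (z : (S × A) × S) : ℝ :=
  w z.1 * b z.1 * (q z.1 - γ * policyValue π q z.2)

/-- The loss `L_w(w, b, q)`, with `(s, a) ∼ μ`, `s' ∼ P(s, a)`. -/
def loss (μ : Measure (S × A)) (P : Kernel (S × A) S) (π : Kernel S A) (d₀ : Measure S) (γ : ℝ)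
    (w b q : S × A → ℝ) : ℝ :=
  |(∫ z, weightedResidual π γ w b q z ∂(μ ⊗ₘ P)) - (1 - γ) * ∫ s, policyValue π q s ∂d₀|

/-- The loss with the expectation over `(s, a, s')` replaced by the average over a sample. -/
def empiricalLoss {n : ℕ} (z : Fin n → (S × A) × S) (π : Kernel S A) (d₀ : Measure S) (γ : ℝ)
    (w b q : S × A → ℝ) : ℝ :=
  |(1 / n : ℝ) * ∑ i, weightedResidual π γ w b q (z i)
    - (1 - γ) * ∫ s, policyValue π q s ∂d₀|

/-- The empirical Nguyen–Wainwright–Jordan objective for the ratio `p / μ`, where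
`x` is a sample from the numerator `p` and `y` a sample from the denominator `μ`. -/
def nwjObjective {X : Type*} {n : ℕ} (x y : Fin n → X) (f : X → ℝ) : ℝ :=
  (1 / n : ℝ) * ∑ i, Real.log (f (x i)) - (1 / n : ℝ) * ∑ i, f (y i)

/-- Empirical Rademacher complexity
`E_ε sup_{g ∈ G} |(2 / n) ∑ i, ε_i g(x_i)|`, with independent uniform signs `ε_i`. -/
def empiricalRademacher {X : Type*} {n : ℕ} (G : Set (X → ℝ)) (x : Fin n → X) : ℝ :=
  (1 / 2 ^ n : ℝ) * ∑ ε : Fin n → Bool,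
    ⨆ g : G, |(2 / n : ℝ) * ∑ i, (if ε i then 1 else -1 : ℝ) * (g : X → ℝ) (x i)|

/-- Rademacher complexity: the expectation of the empirical one over an i.i.d. sample from `P`. -/
def rademacher {X : Type*} [MeasurableSpace X] (P : Measure X) (n : ℕ) (G : Set (X → ℝ)) : ℝ :=
  ∫ x : Fin n → X, empiricalRademacher G x ∂(Measure.pi fun _ => P)

/-- The class `{(x, y) ↦ f(x) - log f(y) : f ∈ F}`. -/
def ratioLossClass {X : Type*} (F : Set (X → ℝ)) : Set (X × X → ℝ) :=
  (fun f p => f p.1 - Real.log (f p.2)) '' F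

/-- The class `{(s, a, s') ↦ w(s, a) b(s, a) (q(s, a) - γ q(s', π)) : w ∈ W, q ∈ Q}`. -/
def residualClass (π : Kernel S A) (γ : ℝ) (W : Set (S × A → ℝ)) (b : S × A → ℝ)
    (Q : Set (S × A → ℝ)) : Set ((S × A) × S → ℝ) :=
  Set.image2 (fun w q => weightedResidual π γ w b q) W Q

end OffEnv

end

set_option linter.unusedSectionVars false

namespace OffEnv

/-! ### Integrals and suprema of bounded functions on discrete spaces. -/

section Discrete

variable {X Y ι : Type*} [MeasurableSpace X] [MeasurableSpace Y]

/-! Write `p` for the simulator occupancy. With the exact ratio `β = p / μ`, the loss at the true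
Q-function is exactly the error to be bounded: the Bellman equation turns `Q - γ T Q` into the mean
reward (`loss_qFunction`). The loss is the absolute value of an affine function of `q`, so a bound
over `Q` passes to its convex hull (`loss_le_of_mem_convexHull`). It remains to show that minimizing
the empirical loss with the estimated ratio nearly minimizes the true loss.

Replacing the sample average by the expectation costs a uniform deviation over the residual class.
Replacing `β` by its estimate costs `CW * CQ` times the sample mean of `|βHat - β|` on the `z_i`.
Since `βHat` may depend on those points, that mean is controlled uniformly over `F`, by the
Rademacher average of the `|f - β|`. Contraction removes the absolute value and `β`, and restoring
the `log f` of the ratio class costs order `1 / √n` (`oneSidedRademacher_abs_sub_le`).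

The remaining mean `∫ |βHat - β| dμ` comes from M-estimation: the excess NWJ risk dominates the
squared Hellinger distance, hence bounds the `L¹` distance by `E + 2√E`
(`integral_abs_sub_densityRatio_le`). The square root in the theorem originates here.

All uniform deviations follow from symmetrization and bounded differences
(`measure_exists_deviation_le`). If `T = 4 R₁ + CF s ≤ 1`, with `R₁` the complexity of the ratio
class and `s = √(2 log(2/δ) / n)`, every linear term is at most a multiple of `√T`. If `T > 1`, the
crude bound `valueError_le_crude` suffices, because the supremum of `β` is at least one.

Countable spaces with measurable singletons are discrete, so suprema over uncountable classes raise
no measurability issue. -/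

lemma integrable_of_abs_le [DiscreteMeasurableSpace X] {P : Measure X} [IsFiniteMeasure P] {f : X → ℝ} {B : ℝ}
    (h : ∀ x, |f x| ≤ B) : Integrable f P :=
  .of_bound (Measurable.of_discrete (f := f)).aestronglyMeasurable B (.of_forall h)

lemma abs_integral_le_of_abs_le {P : Measure X} [IsProbabilityMeasure P] {f : X → ℝ} {B : ℝ}
    (h : ∀ x, |f x| ≤ B) : |∫ x, f x ∂P| ≤ B := by
  simpa using norm_integral_le_of_norm_le_const (μ := P) (f := f) (.of_forall h)

lemma integral_comp_measurePreserving [DiscreteMeasurableSpace Y] {P : Measure X} {P' : Measure Y} {T : X → Y}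
    (hT : MeasurePreserving T P P') (f : Y → ℝ) : ∫ x, f (T x) ∂P = ∫ y, f y ∂P' := by
  rw [← hT.map_eq, integral_map hT.measurable.aemeasurable
    (Measurable.of_discrete (f := f)).aestronglyMeasurable]

lemma bddAbove_range_of_abs_le {u : ι → ℝ} {B : ℝ} (h : ∀ i, |u i| ≤ B) :
    BddAbove (Set.range u) :=
  ⟨B, by rintro _ ⟨i, rfl⟩; exact (abs_le.1 (h i)).2⟩

lemma abs_ciSup_le [Nonempty ι] {u : ι → ℝ} {B : ℝ} (h : ∀ i, |u i| ≤ B) : |⨆ i, u i| ≤ B := by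
  obtain ⟨i⟩ := ‹Nonempty ι›
  exact abs_le.2 ⟨(abs_le.1 (h i)).1.trans (le_ciSup (bddAbove_range_of_abs_le h) i),
    ciSup_le fun i => (abs_le.1 (h i)).2⟩

lemma ciSup_integral_le [DiscreteMeasurableSpace X] [Nonempty ι] {P : Measure X}
    [IsProbabilityMeasure P] {u : ι → X → ℝ}
    {B : ℝ} (h : ∀ i x, |u i x| ≤ B) : ⨆ i, ∫ x, u i x ∂P ≤ ∫ x, ⨆ i, u i x ∂P :=
  ciSup_le fun i => integral_mono (integrable_of_abs_le (h i))
    (integrable_of_abs_le fun x => abs_ciSup_le fun i => h i x)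
    fun x => le_ciSup (bddAbove_range_of_abs_le fun i => h i x) i

end Discrete

/-! ### Exponential moments and McDiarmid's inequality. -/

section BoundedDifferences

variable {X : Type*} [Countable X] [MeasurableSpace X] [MeasurableSingletonClass X]

/-- Centring `v` averages the differences `v x - v y` over `y`, so the result lies in `[-c, c]`, and
Hoeffding's lemma applies. The sharp proxy `c ^ 2 / 4` is not needed; the loss goes into the
universal constant. -/
lemma integral_exp_le_of_oscillation {P : Measure X} [IsProbabilityMeasure P] {v : X → ℝ} {c : ℝ}
    (hv : ∀ x y, |v x - v y| ≤ c) (l : ℝ) :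
    ∫ x, Real.exp (l * (v x - ∫ y, v y ∂P)) ∂P ≤ Real.exp (c ^ 2 * l ^ 2 / 2) := by
  obtain ⟨x₀⟩ : Nonempty X := P.nonempty_of_neZero
  have hvi : Integrable v P := by
    refine integrable_of_abs_le (B := c + |v x₀|) fun x => ?_
    have := abs_add_le (v x - v x₀) (v x₀)
    simp only [sub_add_cancel] at this
    linarith [hv x x₀]
  have hb : ∀ x, v x - ∫ y, v y ∂P ∈ Set.Icc (-c) c := by
    intro x
    rw [Set.mem_Icc, ← abs_le]
    have : v x - ∫ y, v y ∂P = ∫ y, (v x - v y) ∂P := by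
      rw [integral_sub (integrable_const _) hvi]; simp
    rw [this]
    exact abs_integral_le_of_abs_le (hv x)
  have h := (hasSubgaussianMGF_of_mem_Icc_of_integral_eq_zero (μ := P)
    (X := fun x => v x - ∫ y, v y ∂P) Measurable.of_discrete.aemeasurable
    (.of_forall hb) (by simp [integral_sub hvi (integrable_const _)])).mgf_le l
  refine h.trans (Real.exp_le_exp.2 ?_)
  have : (((‖c - -c‖₊ / 2) ^ 2 : NNReal) : ℝ) = c ^ 2 := by
    rw [NNReal.coe_pow, NNReal.coe_div, coe_nnnorm, div_pow, Real.norm_eq_abs, sq_abs]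
    push_cast
    ring
  rw [this]

/-- Doob's martingale argument as an induction: with the first coordinate `a` frozen, the induction
hypothesis controls the fluctuation around the conditional mean `m a`, and `m` itself has
oscillation at most `c`. -/
lemma integral_exp_le_of_bounded_differences {P : Measure X} [IsProbabilityMeasure P] (l c M : ℝ) :
    ∀ (n : ℕ) (h : (Fin n → X) → ℝ), (∀ x, |h x| ≤ M) →
      (∀ x k y, |h x - h (Function.update x k y)| ≤ c) →
      ∫ x, Real.exp (l * (h x - ∫ y, h y ∂Measure.pi fun _ => P)) ∂(Measure.pi fun _ => P)
        ≤ Real.exp (n * (c ^ 2 * l ^ 2 / 2)) := by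
  intro n
  induction n with
  | zero =>
    intro h _ _
    have : ∀ x : Fin 0 → X, h x = h Fin.elim0 := fun x => by rw [Subsingleton.elim x Fin.elim0]
    simp [this]
  | succ n ih =>
    intro h hM hc
    set ν : Measure (Fin n → X) := Measure.pi fun _ => P
    have key : ∀ F : (Fin (n + 1) → X) → ℝ, ∀ B, (∀ x, |F x| ≤ B) →
        ∫ x, F x ∂(Measure.pi fun _ => P) = ∫ a, ∫ y, F (Fin.cons a y) ∂ν ∂P := by
      intro F B hF
      have hmp := measurePreserving_piFinSuccAbove (fun _ : Fin (n + 1) => P) 0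
      have h1 := integral_comp_measurePreserving hmp
        (fun p => F ((MeasurableEquiv.piFinSuccAbove (fun _ => X) 0).symm p))
      simp only [MeasurableEquiv.symm_apply_apply] at h1
      rw [h1, integral_prod _ (integrable_of_abs_le fun p => hF _)]
      simp [MeasurableEquiv.piFinSuccAbove, Fin.insertNthEquiv, ν]
    set m : X → ℝ := fun a => ∫ y, h (Fin.cons a y) ∂ν
    have hm : ∫ y, h y ∂(Measure.pi fun _ => P) = ∫ a, m a ∂P := key h M hM
    have hmM : ∀ a, |m a| ≤ M := fun a => abs_integral_le_of_abs_le fun y => hM _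
    have hmc : ∀ a b, |m a - m b| ≤ c := by
      intro a b
      rw [← integral_sub (integrable_of_abs_le fun y => hM _) (integrable_of_abs_le fun y => hM _)]
      refine abs_integral_le_of_abs_le fun y => ?_
      simpa [Fin.update_cons_zero] using hc (Fin.cons a y) 0 b
    have hIM : |∫ a, m a ∂P| ≤ M := abs_integral_le_of_abs_le hmM
    have hexp : ∀ r, |r| ≤ 2 * M → |Real.exp (l * r)| ≤ Real.exp (|l| * (2 * M)) := by
      intro r hr
      rw [abs_of_pos (Real.exp_pos _), Real.exp_le_exp]
      exact (le_abs_self _).trans (by rw [abs_mul]; gcongr)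
    have hsub : ∀ r q : ℝ, |r| ≤ M → |q| ≤ M → |r - q| ≤ 2 * M := fun r q hr hq =>
      (abs_sub r q).trans (by linarith)
    rw [hm, key _ _ fun x => hexp _ (hsub _ _ (hM x) hIM)]
    have hfac : ∀ a, ∫ y, Real.exp (l * (h (Fin.cons a y) - ∫ a, m a ∂P)) ∂ν ≤
        Real.exp (l * (m a - ∫ a, m a ∂P)) * Real.exp (n * (c ^ 2 * l ^ 2 / 2)) := by
      intro a
      have := ih (fun y => h (Fin.cons a y)) (fun y => hM _) (fun x k y => by
        simpa [Fin.cons_update] using hc (Fin.cons a x) k.succ y)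
      have e : ∀ y, Real.exp (l * (h (Fin.cons a y) - ∫ a, m a ∂P)) =
          Real.exp (l * (m a - ∫ a, m a ∂P)) * Real.exp (l * (h (Fin.cons a y) - m a)) := by
        intro y; rw [← Real.exp_add]; ring_nf
      simp_rw [e, integral_const_mul]
      exact mul_le_mul_of_nonneg_left this (Real.exp_pos _).le
    refine (integral_mono (integrable_of_abs_le (B := Real.exp (|l| * (2 * M))) fun a =>
        abs_integral_le_of_abs_le fun y => hexp _ (hsub _ _ (hM _) hIM))
      ((integrable_of_abs_le fun a => hexp _ (hsub _ _ (hmM a) hIM)).mul_const _) hfac).trans ?_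
    rw [integral_mul_const]
    refine (mul_le_mul_of_nonneg_right (integral_exp_le_of_oscillation hmc l)
      (Real.exp_pos _).le).trans ?_
    rw [← Real.exp_add]
    push_cast
    ring_nf
    rfl

/-- McDiarmid's bounded differences inequality, with a non-optimal constant. -/
lemma measure_ge_le_of_bounded_differences {P : Measure X} [IsProbabilityMeasure P] {c M : ℝ}
    {n : ℕ} {h : (Fin n → X) → ℝ} (hM : ∀ x, |h x| ≤ M)
    (hc : ∀ x k y, |h x - h (Function.update x k y)| ≤ c) {t : ℝ} (ht : 0 ≤ t) :
    (Measure.pi fun _ => P).real {x | t ≤ h x - ∫ y, h y ∂Measure.pi fun _ => P} ≤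
      Real.exp (-t ^ 2 / (2 * (n * c ^ 2))) := by
  have hM' : |∫ y, h y ∂Measure.pi fun _ => P| ≤ M := abs_integral_le_of_abs_le hM
  have hs : HasSubgaussianMGF (fun x => h x - ∫ y, h y ∂Measure.pi fun _ => P)
      ⟨n * c ^ 2, by positivity⟩ (Measure.pi fun _ => P) := by
    refine ⟨fun l => integrable_of_abs_le (B := Real.exp (|l| * (2 * M))) fun x => ?_, fun l => ?_⟩
    · rw [abs_of_pos (Real.exp_pos _), Real.exp_le_exp]
      refine (le_abs_self _).trans ?_
      rw [abs_mul]
      gcongr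
      exact (abs_sub _ _).trans (by linarith [hM x])
    · refine (integral_exp_le_of_bounded_differences l c M n h hM hc).trans (le_of_eq ?_)
      congr 1
      change _ = (n * c ^ 2 : ℝ) * l ^ 2 / 2
      ring
  exact hs.measure_ge_le ht

end BoundedDifferences

/-! ### Contraction and moment bounds for averages over signs. -/

/-- The sign attached to a Boolean. -/
def boolSign (b : Bool) : ℝ := if b then 1 else -1

@[simp] lemma boolSign_true : boolSign true = 1 := by simp [boolSign]

@[simp] lemma boolSign_false : boolSign false = -1 := by simp [boolSign]

@[simp] lemma abs_boolSign (b : Bool) : |boolSign b| = 1 := by cases b <;> simp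

lemma boolSign_not (b : Bool) : boolSign (!b) = -boolSign b := by cases b <;> simp

lemma abs_sum_le_of_abs_le {n : ℕ} {a : Fin n → ℝ} {B : ℝ} (h : ∀ k, |a k| ≤ B) :
    |∑ k, a k| ≤ n * B :=
  (Finset.abs_sum_le_sum_abs _ _).trans ((Finset.sum_le_sum fun k _ => h k).trans (by simp))

lemma abs_sum_boolSign_mul_le {n : ℕ} (ε : Fin n → Bool) {a : Fin n → ℝ} {B : ℝ}
    (h : ∀ k, |a k| ≤ B) : |∑ k, boolSign (ε k) * a k| ≤ n * B :=
  abs_sum_le_of_abs_le fun k => by simpa [abs_mul] using h k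

lemma sum_fin_succ_bool {n : ℕ} (f : (Fin (n + 1) → Bool) → ℝ) :
    ∑ ε, f ε = ∑ ε : Fin n → Bool, (f (Fin.cons true ε) + f (Fin.cons false ε)) := by
  rw [← (Fin.consEquiv fun _ => Bool).sum_comp f, Fintype.sum_prod_type, Fintype.sum_bool,
    ← Finset.sum_add_distrib]
  rfl

section Signs

variable {ι : Type*} [Nonempty ι]

/-- The left side is a supremum over pairs `(i, j)` of `p i + p j + (v i - v j)`. Bounding the
difference by `|a i - a j|` costs nothing, as exchanging `i` and `j` gives `a i - a j` either sign.
-/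
lemma iSup_add_iSup_le_of_contraction {p v a : ι → ℝ} {B : ℝ} (hp : ∀ i, |p i| ≤ B)
    (ha : ∀ i, |a i| ≤ B) (hva : ∀ i j, |v i - v j| ≤ |a i - a j|) :
    (⨆ i, (p i + v i)) + ⨆ i, (p i - v i) ≤ (⨆ i, (p i + a i)) + ⨆ i, (p i - a i) := by
  have h1 := le_ciSup (bddAbove_range_of_abs_le (u := fun i => p i + a i) (B := B + B) fun i =>
    (abs_add_le _ _).trans (add_le_add (hp i) (ha i)))
  have h2 := le_ciSup (bddAbove_range_of_abs_le (u := fun i => p i - a i) (B := B + B) fun i =>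
    (abs_sub _ _).trans (add_le_add (hp i) (ha i)))
  rw [← le_sub_iff_add_le]
  refine ciSup_le fun i => ?_
  rw [le_sub_comm]
  refine ciSup_le fun j => ?_
  have h3 := (le_abs_self _).trans (hva i j)
  rcases abs_cases (a i - a j) with ⟨e, _⟩ | ⟨e, _⟩
  · linarith [h1 i, h2 j]
  · linarith [h1 j, h2 i]

/-- The one-sided contraction principle for sign averages. -/
lemma sum_iSup_boolSign_le_of_contraction {B : ℝ} : ∀ (n : ℕ) (v a : Fin n → ι → ℝ),
    (∀ k i, |v k i| ≤ B) → (∀ k i, |a k i| ≤ B) → (∀ k i j, |v k i - v k j| ≤ |a k i - a k j|) →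
    ∀ (u : ι → ℝ) (M : ℝ), (∀ i, |u i| ≤ M) →
      ∑ ε : Fin n → Bool, ⨆ i, (u i + ∑ k, boolSign (ε k) * v k i) ≤
        ∑ ε : Fin n → Bool, ⨆ i, (u i + ∑ k, boolSign (ε k) * a k i) := by
  intro n
  induction n with
  | zero => simp
  | succ n ih =>
    intro v a hv ha hva u M hu
    obtain ⟨i₀⟩ := ‹Nonempty ι›
    have hB : 0 ≤ B := (abs_nonneg _).trans (hv 0 i₀)
    -- The arbitrary offset `u` is what lets the induction run: the first signed coordinate joins
    -- the offset while the tail is exchanged, and the two-point lemma then exchanges that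
    -- coordinate.
    have h1 : ∀ b : Bool, _ := fun b => ih (fun k => v k.succ) (fun k => a k.succ)
      (fun k => hv k.succ) (fun k => ha k.succ) (fun k => hva k.succ)
      (fun i => u i + boolSign b * v 0 i) (M + B) fun i => (abs_add_le _ _).trans
        (add_le_add (hu i) (by simpa [abs_mul] using hv 0 i))
    rw [sum_fin_succ_bool, sum_fin_succ_bool, Finset.sum_add_distrib]
    have h2 := add_le_add (h1 true) (h1 false)
    simp only [Fin.sum_univ_succ, Fin.cons_zero, Fin.cons_succ, ← add_assoc]
    refine h2.trans ?_
    rw [← Finset.sum_add_distrib]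
    refine Finset.sum_le_sum fun ε _ => ?_
    have h3 := iSup_add_iSup_le_of_contraction
      (p := fun i => u i + ∑ k : Fin n, boolSign (ε k) * a k.succ i) (v := v 0) (a := a 0)
      (B := M + (n + 1) * B)
      (fun i => (abs_add_le _ _).trans (add_le_add (hu i)
        ((abs_sum_boolSign_mul_le ε fun k => ha k.succ i).trans (by linarith))))
      (fun i => (ha 0 i).trans (by
        have : 0 ≤ M := (abs_nonneg _).trans (hu i)
        nlinarith [mul_nonneg n.cast_nonneg hB])) (hva 0)
    simp only [boolSign_true, boolSign_false, one_mul, neg_one_mul, ← sub_eq_add_neg]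
    simp only [add_right_comm _ (_ : ℝ) (∑ k, _), sub_add_eq_add_sub]
    exact h3

lemma sum_sq_sum_boolSign (n : ℕ) :
    ∑ ε : Fin n → Bool, (∑ k, boolSign (ε k)) ^ 2 = 2 ^ n * n := by
  induction n with
  | zero => simp
  | succ n ih =>
    rw [sum_fin_succ_bool]
    simp only [Fin.sum_univ_succ, Fin.cons_zero, Fin.cons_succ, boolSign_true, boolSign_false]
    have : ∀ ε : Fin n → Bool, (1 + ∑ k, boolSign (ε k)) ^ 2 + (-1 + ∑ k, boolSign (ε k)) ^ 2
        = 2 * (∑ k, boolSign (ε k)) ^ 2 + 2 := fun ε => by ring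
    simp only [this, Finset.sum_add_distrib, ← Finset.mul_sum, ih]
    simp
    ring

/-- The second moment bounds the first through the pointwise inequality `|x| ≤ x² / (2√n) + √n / 2`.
-/
lemma sum_abs_sum_boolSign_le {n : ℕ} (hn : 0 < n) :
    ∑ ε : Fin n → Bool, |∑ k, boolSign (ε k)| ≤ 2 ^ n * √n := by
  have hs : 0 < √(n : ℝ) := Real.sqrt_pos.2 (by exact_mod_cast hn)
  have hss : √(n : ℝ) * √n = n := Real.mul_self_sqrt n.cast_nonneg
  have h : ∀ ε : Fin n → Bool, |∑ k, boolSign (ε k)| ≤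
      (1 / (2 * √n)) * (∑ k, boolSign (ε k)) ^ 2 + √n / 2 := by
    intro ε
    have h0 := sq_nonneg (|∑ k, boolSign (ε k)| - √n)
    rw [sub_sq, sq_abs] at h0
    rw [div_mul_eq_mul_div, one_mul, div_add_div _ _ (by positivity) two_ne_zero,
      le_div_iff₀ (by positivity)]
    nlinarith
  refine (Finset.sum_le_sum fun ε _ => h ε).trans (le_of_eq ?_)
  rw [Finset.sum_add_distrib, ← Finset.mul_sum, sum_sq_sum_boolSign]
  simp only [Finset.sum_const, Finset.card_univ, Fintype.card_fun, Fintype.card_bool,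
    Fintype.card_fin, nsmul_eq_mul, Nat.cast_pow, Nat.cast_ofNat]
  field_simp
  nlinarith

end Signs

/-! ### Rademacher averages, symmetrization and uniform deviations. -/

/-- Rademacher average of an indexed family, without absolute values. -/
noncomputable def oneSidedRademacher {X ι : Type*} [MeasurableSpace X] (P : Measure X) (n : ℕ)
    (g : ι → X → ℝ) : ℝ :=
  ∫ x : Fin n → X, (1 / 2 ^ n : ℝ) * ∑ ε : Fin n → Bool,
    ⨆ i, (2 / n : ℝ) * ∑ k, boolSign (ε k) * g i (x k) ∂(Measure.pi fun _ => P)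

lemma abs_two_div_mul_sum_le {n : ℕ} (ε : Fin n → Bool) {a : Fin n → ℝ} {B : ℝ}
    (h : ∀ k, |a k| ≤ B) : |(2 / n : ℝ) * ∑ k, boolSign (ε k) * a k| ≤ 2 / n * (n * B) := by
  rw [abs_mul, abs_of_nonneg (by positivity : (0 : ℝ) ≤ 2 / n)]
  exact mul_le_mul_of_nonneg_left (abs_sum_boolSign_mul_le ε h) (by positivity)

lemma abs_signAverage_le {X ι : Type*} [Nonempty ι] {n : ℕ} {g : ι → X → ℝ} {B : ℝ} (hg : ∀ i x, |g i x| ≤ B)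
    (x : Fin n → X) :
    |(1 / 2 ^ n : ℝ) * ∑ ε : Fin n → Bool,
      ⨆ i, (2 / n : ℝ) * ∑ k, boolSign (ε k) * g i (x k)| ≤
      1 / 2 ^ n * ∑ _ε : Fin n → Bool, 2 / n * (n * B) := by
  rw [abs_mul, abs_of_nonneg (by positivity)]
  refine mul_le_mul_of_nonneg_left ((Finset.abs_sum_le_sum_abs _ _).trans ?_) (by positivity)
  exact Finset.sum_le_sum fun ε _ => abs_ciSup_le fun i => abs_two_div_mul_sum_le ε fun k => hg i _

lemma rademacher_nonneg {X : Type*} [MeasurableSpace X] (P : Measure X) (n : ℕ) (G : Set (X → ℝ)) : 0 ≤ rademacher P n G :=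
  integral_nonneg fun _ => mul_nonneg (by positivity)
    (Finset.sum_nonneg fun _ _ => Real.iSup_nonneg fun _ => abs_nonneg _)

section Rademacher

variable {X Y ι : Type*} [Countable X] [MeasurableSpace X] [MeasurableSingletonClass X]
  [Countable Y] [MeasurableSpace Y] [MeasurableSingletonClass Y] [Nonempty ι]

lemma oneSidedRademacher_eq_sum (P : Measure X) [IsProbabilityMeasure P] (n : ℕ)
    {g : ι → X → ℝ} {B : ℝ} (hg : ∀ i x, |g i x| ≤ B) :
    oneSidedRademacher P n g = (1 / 2 ^ n : ℝ) * ∑ ε : Fin n → Bool,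
      ∫ x : Fin n → X, ⨆ i, (2 / n : ℝ) * ∑ k, boolSign (ε k) * g i (x k)
        ∂(Measure.pi fun _ => P) := by
  rw [oneSidedRademacher, integral_const_mul, integral_finsetSum]
  exact fun ε _ => integrable_of_abs_le fun x => abs_ciSup_le fun i =>
    abs_two_div_mul_sum_le ε fun k => hg i _

/-- Each `g i` is a member of `G` up to sign, and the absolute value in the two-sided complexity
covers both signs. -/
lemma oneSidedRademacher_le_rademacher (P : Measure X) [IsProbabilityMeasure P] (n : ℕ)
    {g : ι → X → ℝ} {G : Set (X → ℝ)} {B : ℝ} (hG : ∀ h ∈ G, ∀ x, |h x| ≤ B)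
    (hg : ∀ i, ∃ h ∈ G, g i = h ∨ g i = -h) :
    oneSidedRademacher P n g ≤ rademacher P n G := by
  have hgB : ∀ i x, |g i x| ≤ B := by
    intro i x
    obtain ⟨h, hh, e | e⟩ := hg i
    · rw [e]; exact hG h hh x
    · rw [e, Pi.neg_apply, abs_neg]; exact hG h hh x
  have hne : Nonempty G := by
    obtain ⟨i⟩ := ‹Nonempty ι›
    obtain ⟨h, hh, -⟩ := hg i
    exact ⟨h, hh⟩
  have hb : ∀ (x : Fin n → X) (ε : Fin n → Bool) (h : G),
      |(|(2 / n : ℝ) * ∑ i, boolSign (ε i) * (h : X → ℝ) (x i)|)| ≤ 2 / n * (n * B) :=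
    fun x ε h => by rw [abs_abs]; exact abs_two_div_mul_sum_le ε fun k => hG h h.2 _
  refine integral_mono (integrable_of_abs_le (abs_signAverage_le hgB))
    (integrable_of_abs_le (B := 1 / 2 ^ n * ∑ _ε : Fin n → Bool, 2 / n * (n * B)) fun x => ?_)
    fun x => ?_
  · rw [empiricalRademacher, abs_mul, abs_of_nonneg (by positivity : (0 : ℝ) ≤ 1 / 2 ^ n)]
    refine mul_le_mul_of_nonneg_left ((Finset.abs_sum_le_sum_abs _ _).trans ?_) (by positivity)
    exact Finset.sum_le_sum fun ε _ => abs_ciSup_le fun h => hb x ε h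
  · refine mul_le_mul_of_nonneg_left (Finset.sum_le_sum fun ε _ => ciSup_le fun i => ?_)
      (by positivity)
    obtain ⟨h, hh, e⟩ := hg i
    refine le_trans ?_ (le_ciSup (bddAbove_range_of_abs_le (hb x ε)) ⟨h, hh⟩)
    rcases e with e | e
    · rw [e]; exact le_abs_self _
    · rw [e, ← abs_neg, ← mul_neg, ← Finset.sum_neg_distrib]
      simp only [Pi.neg_apply, mul_neg]
      exact le_abs_self _

lemma oneSidedRademacher_le_of_contraction (P : Measure X) [IsProbabilityMeasure P] (n : ℕ)
    {v a : ι → X → ℝ} {B : ℝ} (hv : ∀ i x, |v i x| ≤ B) (ha : ∀ i x, |a i x| ≤ B)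
    (hva : ∀ i j x, |v i x - v j x| ≤ |a i x - a j x|) :
    oneSidedRademacher P n v ≤ oneSidedRademacher P n a := by
  refine integral_mono (integrable_of_abs_le (abs_signAverage_le hv))
    (integrable_of_abs_le (abs_signAverage_le ha)) fun x => ?_
  refine mul_le_mul_of_nonneg_left ?_ (by positivity)
  simp only [← Real.mul_iSup_of_nonneg (by positivity : (0 : ℝ) ≤ 2 / n), ← Finset.mul_sum]
  refine mul_le_mul_of_nonneg_left ?_ (by positivity)
  simpa using sum_iSup_boolSign_le_of_contraction n (fun k i => v i (x k)) (fun k i => a i (x k))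
    (fun k i => hv i _) (fun k i => ha i _) (fun k i j => hva i j _) (fun _ => 0) 0 (by simp)

/-- Averaging out the second coordinate costs at most a term of order `1 / √n`. -/
lemma oneSidedRademacher_le_prod (P : Measure X) (P' : Measure Y) [IsProbabilityMeasure P]
    [IsProbabilityMeasure P'] {n : ℕ} (hn : 0 < n) {f : ι → X → ℝ} {l : ι → Y → ℝ} {B M : ℝ}
    (hf : ∀ i x, |f i x| ≤ B) (hl : ∀ i y, |l i y| ≤ M) :
    oneSidedRademacher P n f ≤
      oneSidedRademacher (P.prod P') n (fun i p => f i p.1 - l i p.2) + 2 * M / √n := by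
  have hn' : (0 : ℝ) < n := by exact_mod_cast hn
  have hg : ∀ i (p : X × Y), |f i p.1 - l i p.2| ≤ B + M := fun i p =>
    (abs_sub _ _).trans (add_le_add (hf i _) (hl i _))
  have hM : 0 ≤ M := by
    obtain ⟨i⟩ := ‹Nonempty ι›
    obtain ⟨y⟩ := P'.nonempty_of_neZero
    exact (abs_nonneg _).trans (hl i y)
  rw [oneSidedRademacher_eq_sum P n hf, oneSidedRademacher_eq_sum _ n hg]
  have key : ∀ ε : Fin n → Bool,
      ∫ x : Fin n → X, ⨆ i, (2 / n : ℝ) * ∑ k, boolSign (ε k) * f i (x k) ∂(Measure.pi fun _ => P)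
      ≤ (∫ z : Fin n → X × Y, ⨆ i, (2 / n : ℝ) * ∑ k, boolSign (ε k) * (f i (z k).1 - l i (z k).2)
          ∂(Measure.pi fun _ => P.prod P')) + 2 / n * M * |∑ k, boolSign (ε k)| := by
    intro ε
    have h1 := integral_comp_measurePreserving
      (measurePreserving_arrowProdEquivProdArrow X Y (Fin n) (fun _ => P) (fun _ => P'))
      (fun p => ⨆ i, (2 / n : ℝ) * ∑ k, boolSign (ε k) * (f i (p.1 k) - l i (p.2 k)))
    have h2 : ∀ p : (Fin n → X) × (Fin n → Y), ∀ i,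
        |(2 / n : ℝ) * ∑ k, boolSign (ε k) * (f i (p.1 k) - l i (p.2 k))| ≤
          2 / n * (n * (B + M)) :=
      fun p i => abs_two_div_mul_sum_le ε fun k => hg i (p.1 k, p.2 k)
    refine le_trans ?_ (add_le_add_left (ge_of_eq h1) _)
    rw [integral_prod _ (integrable_of_abs_le fun p => abs_ciSup_le (h2 p))]
    have h3 : ∫ _x : Fin n → X, (2 / n * M * |∑ k, boolSign (ε k)|) ∂(Measure.pi fun _ => P) =
      2 / n * M * |∑ k, boolSign (ε k)| := by simp
    rw [← h3, ← integral_add (integrable_of_abs_le fun x => abs_integral_le_of_abs_le fun y =>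
      abs_ciSup_le (h2 (x, y))) (integrable_const _)]
    -- Jensen in the second sample: a supremum of means is at most the mean of the supremum. The
    -- mean of `l i` then leaves only a multiple of `∑ k, boolSign (ε k)`.
    refine integral_mono (integrable_of_abs_le fun x => abs_ciSup_le fun i =>
      abs_two_div_mul_sum_le ε fun k => hf i _) ((integrable_of_abs_le fun x =>
        abs_integral_le_of_abs_le fun y => abs_ciSup_le (h2 (x, y))).add (integrable_const _))
      fun x => ciSup_le fun i => ?_
    have h4 := (le_ciSup (bddAbove_range_of_abs_le fun i => abs_integral_le_of_abs_le
      (P := Measure.pi fun _ => P') fun y => h2 (x, y) i) i).trans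
      (ciSup_integral_le (P := Measure.pi fun _ => P') fun i y => h2 (x, y) i)
    have h5 : ∀ k : Fin n, ∫ y : Fin n → Y, l i (y k) ∂(Measure.pi fun _ => P') =
        ∫ y, l i y ∂P' := fun k =>
      integral_comp_measurePreserving (measurePreserving_eval (fun _ => P') k) (l i)
    have h6 : ∫ y : Fin n → Y, (2 / n : ℝ) * ∑ k, boolSign (ε k) * (f i (x k) - l i (y k))
        ∂(Measure.pi fun _ => P') = (2 / n : ℝ) * ∑ k, boolSign (ε k) * f i (x k) -
          2 / n * (∫ y, l i y ∂P') * ∑ k, boolSign (ε k) := by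
      rw [integral_const_mul, integral_finsetSum _ fun k _ =>
        integrable_of_abs_le (B := B + M) fun y => by
          simpa [abs_mul] using hg i (x k, y k)]
      simp_rw [integral_const_mul]
      have : ∀ k, ∫ y : Fin n → Y, (f i (x k) - l i (y k)) ∂(Measure.pi fun _ => P') =
          f i (x k) - ∫ y, l i y ∂P' := fun k => by
        rw [integral_sub (integrable_const _) (integrable_of_abs_le fun y => hl i _), h5]; simp
      simp only [this, mul_sub, Finset.sum_sub_distrib, ← Finset.sum_mul]
      ring
    simp only at h4
    rw [h6] at h4
    have h7 : 2 / n * (∫ y, l i y ∂P') * ∑ k, boolSign (ε k) ≤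
        2 / n * M * |∑ k, boolSign (ε k)| := by
      refine (le_abs_self _).trans ?_
      rw [abs_mul, abs_mul, abs_of_nonneg (by positivity : (0 : ℝ) ≤ 2 / n)]
      have := abs_integral_le_of_abs_le (P := P') (hl i)
      gcongr
    linarith
  have h8 := mul_le_mul_of_nonneg_left (Finset.sum_le_sum fun ε (_ : ε ∈ Finset.univ) => key ε)
    (by positivity : (0 : ℝ) ≤ 1 / 2 ^ n)
  refine h8.trans ?_
  rw [Finset.sum_add_distrib, mul_add, ← Finset.mul_sum]
  gcongr
  have h9 := sum_abs_sum_boolSign_le hn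
  have hs : 0 < √(n : ℝ) := Real.sqrt_pos.2 hn'
  have hss : √(n : ℝ) * √n = n := Real.mul_self_sqrt n.cast_nonneg
  calc (1 / 2 ^ n : ℝ) * (2 / n * M * ∑ ε : Fin n → Bool, |∑ k, boolSign (ε k)|)
      ≤ (1 / 2 ^ n : ℝ) * (2 / n * M * (2 ^ n * √n)) := by gcongr
    _ = 2 * M / √n := by
      field_simp
      nlinarith

/-- Symmetrization, in the one-sided form. -/
lemma integral_iSup_deviation_le (P : Measure X) [IsProbabilityMeasure P] {n : ℕ} (hn : 0 < n)
    {g : ι → X → ℝ} {B : ℝ} (hg : ∀ i x, |g i x| ≤ B) :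
    ∫ x : Fin n → X, ⨆ i, ((1 / n : ℝ) * ∑ k, g i (x k) - ∫ y, g i y ∂P) ∂(Measure.pi fun _ => P)
      ≤ oneSidedRademacher P n g := by
  have hn' : (0 : ℝ) < n := by exact_mod_cast hn
  set ν : Measure (Fin n → X) := Measure.pi fun _ => P with hν
  set V : (Fin n → Bool) → (Fin n → X) → ℝ :=
    fun ε x => ⨆ i, (2 / n : ℝ) * ∑ k, boolSign (ε k) * g i (x k) with hV
  have hVb : ∀ ε x, |V ε x| ≤ 2 / n * (n * B) := fun ε x => abs_ciSup_le fun i =>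
    abs_two_div_mul_sum_le ε fun k => hg i _
  set U : (Fin n → Bool) → (Fin n → X × X) → ℝ := fun ε z =>
    ⨆ i, (1 / n : ℝ) * ∑ k, boolSign (ε k) * (g i (z k).1 - g i (z k).2) with hU
  have hd : ∀ i (p : X × X), |g i p.1 - g i p.2| ≤ B + B := fun i p =>
    (abs_sub _ _).trans (add_le_add (hg i _) (hg i _))
  have hUib : ∀ (ε : Fin n → Bool) (z : Fin n → X × X) i,
      |(1 / n : ℝ) * ∑ k, boolSign (ε k) * (g i (z k).1 - g i (z k).2)| ≤
        1 / n * (n * (B + B)) := by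
    intro ε z i
    rw [abs_mul, abs_of_nonneg (by positivity : (0 : ℝ) ≤ 1 / n)]
    exact mul_le_mul_of_nonneg_left (abs_sum_boolSign_mul_le ε fun k => hd i (z k)) (by positivity)
  have hUb : ∀ ε z, |U ε z| ≤ 1 / n * (n * (B + B)) := fun ε z => abs_ciSup_le (hUib ε z)
  set U₀ : ℝ := ∫ z, U (fun _ => true) z ∂(Measure.pi fun _ => P.prod P) with hU₀
  have hdev : ∀ (x : Fin n → X) i, |(1 / n : ℝ) * ∑ k, g i (x k) - ∫ y, g i y ∂P| ≤
      1 / n * (n * B) + B := by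
    intro x i
    refine (abs_sub _ _).trans (add_le_add ?_ (abs_integral_le_of_abs_le (hg i)))
    rw [abs_mul, abs_of_nonneg (by positivity : (0 : ℝ) ≤ 1 / n)]
    exact mul_le_mul_of_nonneg_left (abs_sum_le_of_abs_le fun k => hg i _) (by positivity)
  -- An independent second sample replaces the population mean, again by Jensen.
  have ghost : ∫ x : Fin n → X, ⨆ i, ((1 / n : ℝ) * ∑ k, g i (x k) - ∫ y, g i y ∂P) ∂ν ≤ U₀ := by
    have h1 := integral_comp_measurePreserving
      (measurePreserving_arrowProdEquivProdArrow X X (Fin n) (fun _ => P) (fun _ => P))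
      (fun p => U (fun _ => true) fun k => (p.1 k, p.2 k))
    refine le_trans ?_ (ge_of_eq h1)
    rw [integral_prod _ (integrable_of_abs_le fun p => hUb _ _)]
    refine integral_mono (integrable_of_abs_le fun x => abs_ciSup_le (hdev x))
      (integrable_of_abs_le fun x => abs_integral_le_of_abs_le fun y => hUb _ _)
      fun x => ciSup_le fun i => ?_
    have h4 := (le_ciSup (bddAbove_range_of_abs_le fun i => abs_integral_le_of_abs_le
      (P := ν) fun y => hUib (fun _ => true) (fun k => (x k, y k)) i) i).trans
      (ciSup_integral_le (P := ν) fun i y => hUib (fun _ => true) (fun k => (x k, y k)) i)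
    refine le_trans (le_of_eq ?_) h4
    have h5 : ∀ k : Fin n, ∫ y : Fin n → X, g i (y k) ∂ν = ∫ y, g i y ∂P := fun k =>
      integral_comp_measurePreserving (measurePreserving_eval (fun _ => P) k) (g i)
    have h6 : ∀ k, ∫ y : Fin n → X, (g i (x k) - g i (y k)) ∂ν =
        g i (x k) - ∫ y, g i y ∂P := fun k => by
      rw [integral_sub (integrable_const _) (integrable_of_abs_le fun y => hg i _), h5]; simp
    simp only [boolSign_true, one_mul]
    rw [integral_const_mul, integral_finsetSum _ fun k _ =>
      integrable_of_abs_le fun y => hd i (x k, y k)]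
    simp only [h6, Finset.sum_sub_distrib]
    simp
    field_simp
  -- Exchanging the two copies in any chosen set of coordinates preserves the joint law, so signs
  -- can be inserted freely.
  have swap : ∀ ε, ∫ z, U ε z ∂(Measure.pi fun _ => P.prod P) = U₀ := by
    intro ε
    have hT : MeasurePreserving (fun (z : Fin n → X × X) k => if ε k then z k else (z k).swap)
        (Measure.pi fun _ => P.prod P) (Measure.pi fun _ => P.prod P) := by
      refine measurePreserving_pi (f := fun k (p : X × X) => if ε k then p else p.swap) _ _ fun k => ?_
      cases ε k
      · simpa using Measure.measurePreserving_swap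
      · simpa using! MeasurePreserving.id (P.prod P)
    rw [hU₀, ← integral_comp_measurePreserving hT]
    congr 1
    ext z
    simp only [hU]
    congr 1
    ext i
    congr 1
    refine Finset.sum_congr rfl fun k _ => ?_
    cases ε k <;> simp
  -- The two copies receive opposite sign patterns. Negation permutes the patterns, so averaging
  -- over `ε` makes both terms equal; this matches the factor `2 / n` in the complexity.
  have split : ∀ ε, 2 * U₀ ≤ ∫ x, V ε x ∂ν + ∫ x, V (fun k => !ε k) x ∂ν := by
    intro ε
    have hfst : MeasurePreserving (fun (z : Fin n → X × X) k => (z k).1)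
        (Measure.pi fun _ => P.prod P) ν :=
      measurePreserving_pi _ _ fun _ => measurePreserving_fst
    have hsnd : MeasurePreserving (fun (z : Fin n → X × X) k => (z k).2)
        (Measure.pi fun _ => P.prod P) ν :=
      measurePreserving_pi _ _ fun _ => measurePreserving_snd
    rw [← swap ε, ← integral_comp_measurePreserving hfst, ← integral_comp_measurePreserving hsnd,
      ← integral_add (integrable_of_abs_le fun z => hVb _ _) (integrable_of_abs_le fun z => hVb _ _),
      ← integral_const_mul]
    refine integral_mono ((integrable_of_abs_le fun z => hUb ε z).const_mul 2)
      ((integrable_of_abs_le fun z => hVb _ _).add (integrable_of_abs_le fun z => hVb _ _))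
      fun z => ?_
    simp only [hU]
    rw [Real.mul_iSup_of_nonneg zero_le_two]
    refine ciSup_le fun i => ?_
    have b1 := le_ciSup (bddAbove_range_of_abs_le fun i =>
      abs_two_div_mul_sum_le (n := n) ε fun k => hg i (z k).1) i
    have b2 := le_ciSup (bddAbove_range_of_abs_le fun i =>
      abs_two_div_mul_sum_le (n := n) (fun k => !ε k) fun k => hg i (z k).2) i
    refine le_trans (le_of_eq ?_) (add_le_add b1 b2)
    simp only [boolSign_not, mul_sub, neg_mul, Finset.sum_neg_distrib, Finset.sum_sub_distrib]
    ring
  refine ghost.trans ?_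
  rw [oneSidedRademacher_eq_sum P n hg]
  have hsum := Finset.sum_le_sum fun ε (_ : ε ∈ Finset.univ) => split ε
  have hinv : ∑ ε : Fin n → Bool, ∫ x, V (fun k => !ε k) x ∂ν = ∑ ε, ∫ x, V ε x ∂ν :=
    (Equiv.arrowCongr (Equiv.refl (Fin n)) Equiv.boolNot).sum_comp fun ε => ∫ x, V ε x ∂ν
  rw [Finset.sum_add_distrib, hinv] at hsum
  simp only [Finset.sum_const, Finset.card_univ, Fintype.card_fun, Fintype.card_bool,
    Fintype.card_fin, nsmul_eq_mul, Nat.cast_pow, Nat.cast_ofNat] at hsum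
  rw [one_div, ← div_eq_inv_mul, le_div_iff₀ (by positivity)]
  linarith

/-- Uniform one-sided deviation of empirical means, in terms of the Rademacher average. -/
lemma measure_exists_deviation_le (P : Measure X) [IsProbabilityMeasure P] {n : ℕ} (hn : 0 < n)
    {g : ι → X → ℝ} {B : ℝ} (hg : ∀ i x, |g i x| ≤ B) {Ω : Type*} [MeasurableSpace Ω]
    {Pr : Measure Ω} [IsProbabilityMeasure Pr] {ξ : Fin n → Ω → X}
    (hξ : ∀ k, HasLaw (ξ k) P Pr) (hind : iIndepFun ξ Pr) {s : ℝ} (hs : 0 ≤ s) :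
    Pr {ω | ∃ i, oneSidedRademacher P n g + 4 * B * s <
      (1 / n : ℝ) * ∑ k, g i (ξ k ω) - ∫ y, g i y ∂P} ≤
      ENNReal.ofReal (Real.exp (-(2 * (n * s ^ 2)))) := by
  have hn' : (0 : ℝ) < n := by exact_mod_cast hn
  have hB : 0 ≤ B := by
    obtain ⟨i⟩ := ‹Nonempty ι›
    obtain ⟨y⟩ := P.nonempty_of_neZero
    exact (abs_nonneg _).trans (hg i y)
  set ν : Measure (Fin n → X) := Measure.pi fun _ => P with hν
  set h : (Fin n → X) → ℝ := fun x => ⨆ i, ((1 / n : ℝ) * ∑ k, g i (x k) - ∫ y, g i y ∂P) with hh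
  have hdev : ∀ (x : Fin n → X) i, |(1 / n : ℝ) * ∑ k, g i (x k) - ∫ y, g i y ∂P| ≤ B + B := by
    intro x i
    refine (abs_sub _ _).trans (add_le_add ?_ (abs_integral_le_of_abs_le (hg i)))
    rw [abs_mul, abs_of_nonneg (by positivity : (0 : ℝ) ≤ 1 / n)]
    refine (mul_le_mul_of_nonneg_left (abs_sum_le_of_abs_le fun k => hg i _)
      (by positivity)).trans (le_of_eq ?_)
    field_simp
  have hM : ∀ x, |h x| ≤ B + B := fun x => abs_ciSup_le (hdev x)
  have hsymm : ∫ x, h x ∂ν ≤ oneSidedRademacher P n g := integral_iSup_deviation_le P hn hg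
  have hlaw : Pr.map (fun ω k => ξ k ω) = ν := by
    rw [(iIndepFun_iff_map_fun_eq_pi_map fun k => (hξ k).aemeasurable).1 hind]
    simp [hν, fun k => (hξ k).map_eq]
  have hsub : {ω | ∃ i, oneSidedRademacher P n g + 4 * B * s <
      (1 / n : ℝ) * ∑ k, g i (ξ k ω) - ∫ y, g i y ∂P} ⊆
      (fun ω k => ξ k ω) ⁻¹' {x | 4 * B * s < h x - ∫ y, h y ∂ν} := by
    rintro ω ⟨i, hi⟩
    have := le_ciSup (bddAbove_range_of_abs_le (hdev fun k => ξ k ω)) i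
    change 4 * B * s < h (fun k => ξ k ω) - _
    simp only [hh] at hsymm ⊢
    linarith
  refine (measure_mono hsub).trans ?_
  rw [← Measure.map_apply_of_aemeasurable (aemeasurable_pi_lambda _ fun k => (hξ k).aemeasurable)
    (MeasurableSet.of_discrete), hlaw]
  -- For `B = 0` the exponent below would be a division by zero, but then the strict deviation event
  -- is empty.
  rcases hB.eq_or_lt with rfl | hB
  · have h0 : ∀ x, h x = 0 := fun x => by simpa using hM x
    simp [h0]
  have hone : ∀ x k y, h x ≤ h (Function.update x k y) + 2 * B / n := by
    intro x k y
    refine ciSup_le fun i => ?_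
    have h1 := le_ciSup (bddAbove_range_of_abs_le (hdev (Function.update x k y))) i
    refine le_trans ?_ (add_le_add_left h1 _)
    have h2 : ∑ j, g i (x j) ≤ ∑ j, g i (Function.update x k y j) + 2 * B := by
      rw [← Finset.add_sum_erase _ _ (Finset.mem_univ k),
        ← Finset.add_sum_erase _ (fun j => g i (Function.update x k y j)) (Finset.mem_univ k)]
      have : ∑ j ∈ Finset.univ.erase k, g i (Function.update x k y j) =
          ∑ j ∈ Finset.univ.erase k, g i (x j) := Finset.sum_congr rfl fun j hj => by
        rw [Function.update_of_ne (Finset.ne_of_mem_erase hj)]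
      rw [this, Function.update_self]
      linarith [(abs_le.1 (hg i (x k))).2, (abs_le.1 (hg i y)).1]
    have h3 := mul_le_mul_of_nonneg_left h2 (by positivity : (0 : ℝ) ≤ 1 / n)
    rw [mul_add, one_div_mul_eq_div (n : ℝ) (2 * B)] at h3
    linarith
  have hc : ∀ x k y, |h x - h (Function.update x k y)| ≤ 2 * B / n := by
    intro x k y
    have h1 := hone x k y
    have h2 := hone (Function.update x k y) k (x k)
    rw [Function.update_idem, Function.update_eq_self] at h2
    exact abs_le.2 ⟨by linarith, by linarith⟩
  have htail := measure_ge_le_of_bounded_differences (P := P) hM hc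
    (by positivity : (0 : ℝ) ≤ 4 * B * s)
  have hexp : -(4 * B * s) ^ 2 / (2 * (n * (2 * B / n) ^ 2)) = -(2 * (n * s ^ 2)) := by
    field_simp
    ring
  rw [hexp] at htail
  rw [← ENNReal.ofReal_toReal (measure_ne_top ν {x | 4 * B * s < h x - ∫ y, h y ∂ν})]
  refine ENNReal.ofReal_le_ofReal (le_trans ?_ htail)
  refine measureReal_mono fun x hx => ?_
  rw [Set.mem_ofPred_eq] at hx ⊢
  exact hx.le

end Rademacher

/-! ### The transition operator and the Bellman equation. -/

lemma abs_policyValue_le {S A : Type*} [MeasurableSpace S] [MeasurableSpace A]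
    (π : Kernel S A) [IsMarkovKernel π] {f : S × A → ℝ} {B : ℝ} (hf : ∀ x, |f x| ≤ B) (s : S) :
    |policyValue π f s| ≤ B :=
  abs_integral_le_of_abs_le fun a => hf (s, a)

/-- The one-step transition operator `(T f)(x) = E_{s' ∼ P(x)} f(s', π)`. -/
noncomputable def transitionOp {S A : Type*} [MeasurableSpace S] [MeasurableSpace A]
    (P : Kernel (S × A) S) (π : Kernel S A)
    (f : S × A → ℝ) (x : S × A) : ℝ :=
  ∫ s, policyValue π f s ∂(P x)

lemma abs_transitionOp_le {S A : Type*} [MeasurableSpace S] [MeasurableSpace A]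
    (P : Kernel (S × A) S) [IsMarkovKernel P] (π : Kernel S A) [IsMarkovKernel π] {f : S × A → ℝ} {B : ℝ}
    (hf : ∀ x, |f x| ≤ B) (x : S × A) :
    |transitionOp P π f x| ≤ B :=
  abs_integral_le_of_abs_le (abs_policyValue_le π hf)

lemma abs_iterate_transitionOp_le {S A : Type*} [MeasurableSpace S] [MeasurableSpace A]
    (P : Kernel (S × A) S) [IsMarkovKernel P] (π : Kernel S A) [IsMarkovKernel π] {f : S × A → ℝ} {B : ℝ}
    (hf : ∀ x, |f x| ≤ B) (t : ℕ) :
    ∀ x, |(transitionOp P π)^[t] f x| ≤ B := by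
  induction t with
  | zero => exact hf
  | succ t ih =>
    rw [Function.iterate_succ_apply']
    exact abs_transitionOp_le P π ih

section Bellman

variable {S A : Type*} [Countable S] [MeasurableSpace S] [MeasurableSingletonClass S]
  [Countable A] [MeasurableSpace A] [MeasurableSingletonClass A]

variable (P : Kernel (S × A) S) [IsMarkovKernel P] (π : Kernel S A) [IsMarkovKernel π]

lemma integral_compProd_policy (ν : Measure S) [IsProbabilityMeasure ν] {f : S × A → ℝ} {B : ℝ}
    (hf : ∀ x, |f x| ≤ B) : ∫ x, f x ∂(ν ⊗ₘ π) = ∫ s, policyValue π f s ∂ν :=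
  Measure.integral_compProd (integrable_of_abs_le hf)

instance isProbabilityMeasure_stateActionLaw (ν : Measure (S × A)) [IsProbabilityMeasure ν]
    (t : ℕ) : IsProbabilityMeasure (stateActionLaw P π ν t) := by
  induction t with
  | zero => simpa [stateActionLaw]
  | succ t ih =>
    rw [stateActionLaw]
    infer_instance

lemma integral_bind_transition (ν : Measure (S × A)) [IsProbabilityMeasure ν] {f : S × A → ℝ}
    {B : ℝ} (hf : ∀ x, |f x| ≤ B) :
    ∫ x, f x ∂(ν.bind P ⊗ₘ π) = ∫ x, transitionOp P π f x ∂ν := by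
  rw [integral_compProd_policy π _ hf, ← Measure.snd_compProd, Measure.snd,
    integral_map measurable_snd.aemeasurable
      (Measurable.of_discrete (f := policyValue π f)).aestronglyMeasurable,
    Measure.integral_compProd (integrable_of_abs_le fun p => abs_policyValue_le π hf p.2)]
  rfl

/-- Duality: pushing the law forward one step is the same as applying the transition operator to the
test function. -/
lemma integral_stateActionLaw (ν : Measure (S × A)) [IsProbabilityMeasure ν] (t : ℕ) :
    ∀ {f : S × A → ℝ} {B : ℝ}, (∀ x, |f x| ≤ B) →
      ∫ x, f x ∂(stateActionLaw P π ν t) = ∫ x, (transitionOp P π)^[t] f x ∂ν := by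
  induction t with
  | zero => intros; rfl
  | succ t ih =>
    intro f B hf
    rw [stateActionLaw, integral_bind_transition P π _ hf, ih (abs_transitionOp_le P π hf),
      Function.iterate_succ_apply]

variable {P π} {R : Kernel (S × A) ℝ} {Rmax : ℝ} {γ : ℝ}

lemma qFunction_eq_tsum (hr : ∀ x, |∫ r, r ∂(R x)| ≤ Rmax) (x : S × A) :
    qFunction P π R γ x =
      ∑' t : ℕ, γ ^ t * (transitionOp P π)^[t] (fun y => ∫ r, r ∂(R y)) x := by
  simp only [qFunction]
  congr 1
  ext t
  rw [integral_stateActionLaw P π _ t hr]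
  simp

lemma hasSum_integral_geometric {X : Type*} [MeasurableSpace X] [DiscreteMeasurableSpace X]
    (ν : Measure X) [IsProbabilityMeasure ν] (h0 : 0 ≤ γ) (h1 : γ < 1) {B : ℝ} {u : ℕ → X → ℝ}
    (hu : ∀ t x, |u t x| ≤ B) :
    HasSum (fun t => γ ^ t * ∫ x, u t x ∂ν) (∫ x, ∑' t, γ ^ t * u t x ∂ν) := by
  have hb : ∀ t x, |γ ^ t * u t x| ≤ γ ^ t * B := fun t x => by
    rw [abs_mul, abs_of_nonneg (pow_nonneg h0 t)]
    exact mul_le_mul_of_nonneg_left (hu t x) (pow_nonneg h0 t)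
  have := hasSum_integral_of_summable_integral_norm (μ := ν) (F := fun t x => γ ^ t * u t x)
    (fun t => integrable_of_abs_le (hb t)) ?_
  · simpa only [integral_const_mul] using this
  · refine Summable.of_nonneg_of_le (fun t => integral_nonneg fun _ => norm_nonneg _) (fun t => ?_)
      ((summable_geometric_of_lt_one h0 h1).mul_right B)
    refine (le_abs_self _).trans (abs_integral_le_of_abs_le fun x => ?_)
    rw [Real.norm_eq_abs, abs_abs]
    exact hb t x

lemma summable_geometric_mul (h0 : 0 ≤ γ) (h1 : γ < 1) {B : ℝ} {u : ℕ → ℝ}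
    (hu : ∀ t, |u t| ≤ B) : Summable fun t => γ ^ t * u t := by
  refine Summable.of_norm_bounded ((summable_geometric_of_lt_one h0 h1).mul_right B) fun t => ?_
  rw [Real.norm_eq_abs, abs_mul, abs_of_nonneg (pow_nonneg h0 t)]
  exact mul_le_mul_of_nonneg_left (hu t) (pow_nonneg h0 t)

/-- The Bellman equation. -/
lemma qFunction_bellman (hr : ∀ x, |∫ r, r ∂(R x)| ≤ Rmax) (h0 : 0 ≤ γ) (h1 : γ < 1)
    (x : S × A) :
    qFunction P π R γ x = (∫ r, r ∂(R x)) + γ * transitionOp P π (qFunction P π R γ) x := by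
  have hT := abs_iterate_transitionOp_le P π hr
  have e : transitionOp P π (qFunction P π R γ) x = ∑' t, γ ^ t *
      (transitionOp P π)^[t + 1] (fun y => ∫ r, r ∂(R y)) x := by
    have h2 : ∀ s, HasSum (fun t => γ ^ t *
        policyValue π ((transitionOp P π)^[t] fun y => ∫ r, r ∂(R y)) s)
        (policyValue π (qFunction P π R γ) s) := by
      intro s
      simp only [policyValue, qFunction_eq_tsum hr]
      exact hasSum_integral_geometric (π s) h0 h1 fun t a => hT t (s, a)
    have h3 := hasSum_integral_geometric (P x) h0 h1
      (u := fun t => policyValue π ((transitionOp P π)^[t] fun y => ∫ r, r ∂(R y)))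
      fun t s => abs_policyValue_le π (hT t) s
    simp only [fun s => (h2 s).tsum_eq] at h3
    rw [transitionOp, ← h3.tsum_eq]
    simp only [Function.iterate_succ_apply']
    rfl
  rw [e, qFunction_eq_tsum hr, (summable_geometric_mul h0 h1 fun t => hT t x).tsum_eq_zero_add,
    ← tsum_mul_left]
  simp only [pow_succ', pow_zero, one_mul, Function.iterate_zero_apply, mul_assoc]

lemma performance_eq_integral_qFunction (hr : ∀ x, |∫ r, r ∂(R x)| ≤ Rmax) (h0 : 0 ≤ γ)
    (h1 : γ < 1) (d₀ : Measure S) [IsProbabilityMeasure d₀] {B : ℝ}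
    (hQ : ∀ x, |qFunction P π R γ x| ≤ B) :
    performance P π R d₀ γ = (1 - γ) * ∫ s, policyValue π (qFunction P π R γ) s ∂d₀ := by
  rw [performance, ← integral_compProd_policy π d₀ hQ]
  simp only [integral_stateActionLaw P π _ _ hr, qFunction_eq_tsum hr]
  rw [(hasSum_integral_geometric (d₀ ⊗ₘ π) h0 h1 fun t x =>
    abs_iterate_transitionOp_le P π hr t x).tsum_eq]

end Bellman

/-! ### The ratio of point masses as a density. -/

lemma densityRatio_nonneg {X : Type*} [MeasurableSpace X] {p μ : Measure X} (x : X) : 0 ≤ densityRatio p μ x :=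
  div_nonneg measureReal_nonneg measureReal_nonneg

/-- The a.e. bound becomes pointwise: where `μ` has no mass the ratio is zero by the convention for
division, and every other point is seen by the a.e. equality. -/
lemma densityRatio_le_of_ae_eq {X : Type*} [MeasurableSpace X] {p μ : Measure X}
    {f : X → ℝ} (hf : f =ᵐ[μ] densityRatio p μ) {B : ℝ}
    (hB : 0 ≤ B) (hfB : ∀ x, f x ≤ B) (x : X) : densityRatio p μ x ≤ B := by
  by_cases hx : μ {x} = 0
  · simp [densityRatio, Measure.real, hx, hB]
  · by_cases e : f x = densityRatio p μ x
    · rw [← e]; exact hfB x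
    · exact absurd (measure_mono_null (Set.singleton_subset_iff.2 e) (ae_iff.1 hf)) hx

section DensityRatio

variable {X : Type*} [Countable X] [MeasurableSpace X] [MeasurableSingletonClass X]
  {p μ : Measure X} [IsProbabilityMeasure p] [IsProbabilityMeasure μ]

lemma eq_withDensity_densityRatio (h : p ≪ μ) :
    p = μ.withDensity fun x => ENNReal.ofReal (densityRatio p μ x) := by
  refine Measure.ext_of_singleton fun x => ?_
  rw [withDensity_apply _ (measurableSet_singleton x), lintegral_singleton]
  by_cases hx : μ {x} = 0
  · rw [hx, mul_zero, h hx]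
  · have hx' : μ.real {x} ≠ 0 := by simpa [Measure.real, ENNReal.toReal_eq_zero_iff] using hx
    rw [← ENNReal.ofReal_toReal (measure_ne_top μ {x}),
      ← ENNReal.ofReal_mul (densityRatio_nonneg x)]
    change _ = ENNReal.ofReal (p.real {x} / μ.real {x} * μ.real {x})
    rw [div_mul_cancel₀ _ hx', Measure.real, ENNReal.ofReal_toReal (measure_ne_top p {x})]

lemma integral_eq_integral_densityRatio_mul (h : p ≪ μ) (f : X → ℝ) :
    ∫ x, f x ∂p = ∫ x, densityRatio p μ x * f x ∂μ := by
  conv_lhs => rw [eq_withDensity_densityRatio h]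
  rw [integral_withDensity_eq_integral_toReal_smul Measurable.of_discrete
    (.of_forall fun _ => ENNReal.ofReal_lt_top)]
  simp [ENNReal.toReal_ofReal (densityRatio_nonneg _)]

end DensityRatio

/-! ### The loss with the exact ratio, and its link to the value error. -/

lemma integral_mem_Icc {X : Type*} [MeasurableSpace X] [DiscreteMeasurableSpace X] (P : Measure X)
    [IsProbabilityMeasure P] {f : X → ℝ} {B : ℝ} (hf : ∀ x, 0 ≤ f x ∧ f x ≤ B) :
    0 ≤ ∫ x, f x ∂P ∧ ∫ x, f x ∂P ≤ B :=
  ⟨integral_nonneg fun x => (hf x).1, (le_abs_self _).trans (abs_integral_le_of_abs_le fun x => by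
    rw [abs_of_nonneg (hf x).1]; exact (hf x).2)⟩

lemma abs_le_of_mem {X : Type*} {f : X → ℝ} {B : ℝ} (hf : ∀ x, 0 ≤ f x ∧ f x ≤ B) (x : X) :
    |f x| ≤ B := by
  rw [abs_of_nonneg (hf x).1]; exact (hf x).2

lemma abs_sub_mul_le {γ C u v : ℝ} (h0 : 0 ≤ γ) (h1 : γ < 1) (hu : 0 ≤ u ∧ u ≤ C)
    (hv : 0 ≤ v ∧ v ≤ C) : |u - γ * v| ≤ C :=
  abs_le.2 ⟨by nlinarith, by nlinarith⟩

section Loss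

variable {S A : Type*} [Countable S] [MeasurableSpace S] [MeasurableSingletonClass S]
  [Countable A] [MeasurableSpace A] [MeasurableSingletonClass A]
  {P : Kernel (S × A) S} [IsMarkovKernel P] {π : Kernel S A} [IsMarkovKernel π]
  {R : Kernel (S × A) ℝ} {Rmax γ : ℝ} {d₀ : Measure S} [IsProbabilityMeasure d₀]
  {μ p : Measure (S × A)} [IsProbabilityMeasure μ] [IsProbabilityMeasure p]
  {CW CQ : ℝ}

lemma policyValue_mem {q : S × A → ℝ} (hq : ∀ x, 0 ≤ q x ∧ q x ≤ CQ) (s : S) :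
    0 ≤ policyValue π q s ∧ policyValue π q s ≤ CQ :=
  integral_mem_Icc (π s) fun a => hq (s, a)

lemma transitionOp_mem {q : S × A → ℝ} (hq : ∀ x, 0 ≤ q x ∧ q x ≤ CQ) (x : S × A) :
    0 ≤ transitionOp P π q x ∧ transitionOp P π q x ≤ CQ :=
  integral_mem_Icc (P x) (policyValue_mem hq)

lemma abs_weightedResidual_le (h0 : 0 ≤ γ) (h1 : γ < 1) {w b q : S × A → ℝ} {B : ℝ}
    (hw : ∀ x, 0 ≤ w x ∧ w x ≤ CW) (hb : ∀ x, 0 ≤ b x ∧ b x ≤ B)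
    (hq : ∀ x, 0 ≤ q x ∧ q x ≤ CQ) (z : (S × A) × S) :
    |weightedResidual π γ w b q z| ≤ CW * B * CQ := by
  have h := abs_sub_mul_le h0 h1 (hq z.1) (policyValue_mem (π := π) hq z.2)
  have hCW := (hw z.1).1.trans (hw z.1).2
  have hB := (hb z.1).1.trans (hb z.1).2
  rw [weightedResidual, abs_mul, abs_mul]
  have h2 := abs_le_of_mem hw z.1
  have h3 := abs_le_of_mem hb z.1
  gcongr

/-- With the exact density ratio, the weighted Bellman residual is an average over `p`. -/
lemma integral_weightedResidual_densityRatio (h0 : 0 ≤ γ) (h1 : γ < 1) (hp : p ≪ μ) {b : ℝ}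
    (hb : ∀ x, densityRatio p μ x ≤ b) {w q : S × A → ℝ}
    (hw : ∀ x, 0 ≤ w x ∧ w x ≤ CW) (hq : ∀ x, 0 ≤ q x ∧ q x ≤ CQ) :
    ∫ z, weightedResidual π γ w (densityRatio p μ) q z ∂(μ ⊗ₘ P) =
      ∫ x, w x * (q x - γ * transitionOp P π q x) ∂p := by
  rw [Measure.integral_compProd (integrable_of_abs_le
    (abs_weightedResidual_le h0 h1 hw (fun x => ⟨densityRatio_nonneg x, hb x⟩) hq)),
    integral_eq_integral_densityRatio_mul hp]
  congr 1
  ext x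
  simp only [weightedResidual]
  rw [integral_const_mul, integral_sub (integrable_const _)
    ((integrable_of_abs_le (abs_policyValue_le π (abs_le_of_mem hq))).const_mul γ),
    integral_const_mul]
  simp only [integral_const, probReal_univ, one_smul, transitionOp]
  ring

lemma loss_densityRatio (h0 : 0 ≤ γ) (h1 : γ < 1) (hp : p ≪ μ) {b : ℝ}
    (hb : ∀ x, densityRatio p μ x ≤ b) {w q : S × A → ℝ}
    (hw : ∀ x, 0 ≤ w x ∧ w x ≤ CW) (hq : ∀ x, 0 ≤ q x ∧ q x ≤ CQ) :
    loss μ P π d₀ γ w (densityRatio p μ) q =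
      |∫ x, w x * (q x - γ * transitionOp P π q x) ∂p - (1 - γ) * ∫ s, policyValue π q s ∂d₀| := by
  rw [loss, integral_weightedResidual_densityRatio h0 h1 hp hb hw hq]

lemma abs_mul_residual_le (h0 : 0 ≤ γ) (h1 : γ < 1) {w q : S × A → ℝ} (hw : ∀ x, |w x| ≤ CW)
    (hq : ∀ x, 0 ≤ q x ∧ q x ≤ CQ) (x : S × A) :
    |w x * (q x - γ * transitionOp P π q x)| ≤ CW * CQ := by
  rw [abs_mul]
  exact mul_le_mul (hw x) (abs_sub_mul_le h0 h1 (hq x) (transitionOp_mem hq x)) (abs_nonneg _)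
    ((abs_nonneg _).trans (hw x))

/-- Provides the upper bound without which a real supremum over `Q` would take its default value. -/
lemma loss_densityRatio_le (h0 : 0 ≤ γ) (h1 : γ < 1) (hp : p ≪ μ) {b : ℝ}
    (hb : ∀ x, densityRatio p μ x ≤ b) {w q : S × A → ℝ}
    (hw : ∀ x, 0 ≤ w x ∧ w x ≤ CW) (hq : ∀ x, 0 ≤ q x ∧ q x ≤ CQ) :
    loss μ P π d₀ γ w (densityRatio p μ) q ≤ CW * CQ + CQ := by
  rw [loss_densityRatio h0 h1 hp hb hw hq]
  refine (abs_sub _ _).trans (add_le_add (abs_integral_le_of_abs_le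
    (abs_mul_residual_le h0 h1 (abs_le_of_mem hw) hq)) ?_)
  obtain ⟨h2, h3⟩ := integral_mem_Icc d₀ (policyValue_mem (π := π) hq)
  rw [abs_of_nonneg (mul_nonneg (by linarith) h2)]
  nlinarith

/-- Changing the weight changes the loss by at most the crude bound `CW * CQ`. -/
lemma loss_densityRatio_le_add (h0 : 0 ≤ γ) (h1 : γ < 1) (hp : p ≪ μ) {b : ℝ}
    (hb : ∀ x, densityRatio p μ x ≤ b) {w w' q : S × A → ℝ}
    (hw : ∀ x, 0 ≤ w x ∧ w x ≤ CW) (hw' : ∀ x, 0 ≤ w' x ∧ w' x ≤ CW)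
    (hq : ∀ x, 0 ≤ q x ∧ q x ≤ CQ) :
    loss μ P π d₀ γ w' (densityRatio p μ) q ≤
      loss μ P π d₀ γ w (densityRatio p μ) q + CW * CQ := by
  rw [loss_densityRatio h0 h1 hp hb hw hq, loss_densityRatio h0 h1 hp hb hw' hq]
  have hsub : ∀ x, |w' x - w x| ≤ CW := fun x => abs_le.2
    ⟨by linarith [hw x, hw' x], by linarith [hw x, hw' x]⟩
  have h := abs_integral_le_of_abs_le (P := p)
    (abs_mul_residual_le (P := P) (π := π) h0 h1 (w := fun x => w' x - w x) hsub hq)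
  simp only [sub_mul] at h
  rw [integral_sub (integrable_of_abs_le (abs_mul_residual_le h0 h1 (abs_le_of_mem hw') hq))
    (integrable_of_abs_le (abs_mul_residual_le h0 h1 (abs_le_of_mem hw) hq))] at h
  set a' := ∫ x, w' x * (q x - γ * transitionOp P π q x) ∂p
  set a := ∫ x, w x * (q x - γ * transitionOp P π q x) ∂p
  set c := (1 - γ) * ∫ s, policyValue π q s ∂d₀
  calc |a' - c| = |(a - c) + (a' - a)| := by ring_nf
    _ ≤ |a - c| + CW * CQ := (abs_add_le _ _).trans (by gcongr)

lemma policyValue_add_smul {q₁ q₂ : S × A → ℝ} (h₁ : ∀ x, 0 ≤ q₁ x ∧ q₁ x ≤ CQ)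
    (h₂ : ∀ x, 0 ≤ q₂ x ∧ q₂ x ≤ CQ) (c₁ c₂ : ℝ) (s : S) :
    policyValue π (c₁ • q₁ + c₂ • q₂) s = c₁ * policyValue π q₁ s + c₂ * policyValue π q₂ s := by
  simp only [policyValue, Pi.add_apply, Pi.smul_apply, smul_eq_mul]
  rw [integral_add ((integrable_of_abs_le fun a => abs_le_of_mem h₁ (s, a)).const_mul _)
    ((integrable_of_abs_le fun a => abs_le_of_mem h₂ (s, a)).const_mul _),
    integral_const_mul, integral_const_mul]

lemma integral_policyValue_add_smul {q₁ q₂ : S × A → ℝ} (h₁ : ∀ x, 0 ≤ q₁ x ∧ q₁ x ≤ CQ)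
    (h₂ : ∀ x, 0 ≤ q₂ x ∧ q₂ x ≤ CQ) (c₁ c₂ : ℝ) (ν : Measure S) [IsProbabilityMeasure ν] :
    ∫ s, policyValue π (c₁ • q₁ + c₂ • q₂) s ∂ν =
      c₁ * ∫ s, policyValue π q₁ s ∂ν + c₂ * ∫ s, policyValue π q₂ s ∂ν := by
  simp only [policyValue_add_smul h₁ h₂]
  rw [integral_add ((integrable_of_abs_le (abs_policyValue_le π (abs_le_of_mem h₁))).const_mul _)
    ((integrable_of_abs_le (abs_policyValue_le π (abs_le_of_mem h₂))).const_mul _),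
    integral_const_mul, integral_const_mul]

/-- A bound on the loss over `Q` extends to the convex hull of `Q`. -/
lemma loss_le_of_mem_convexHull (h0 : 0 ≤ γ) (h1 : γ < 1) (hp : p ≪ μ) {b : ℝ}
    (hb : ∀ x, densityRatio p μ x ≤ b) {w : S × A → ℝ} {Q : Set (S × A → ℝ)}
    (hw : ∀ x, 0 ≤ w x ∧ w x ≤ CW) (hQ : ∀ q ∈ Q, ∀ x, 0 ≤ q x ∧ q x ≤ CQ) {M : ℝ}
    (hM : ∀ q ∈ Q, loss μ P π d₀ γ w (densityRatio p μ) q ≤ M) {q : S × A → ℝ}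
    (hq : q ∈ convexHull ℝ Q) :
    (∀ x, 0 ≤ q x ∧ q x ≤ CQ) ∧ loss μ P π d₀ γ w (densityRatio p μ) q ≤ M := by
  have hconv : Convex ℝ {q : S × A → ℝ |
      (∀ x, 0 ≤ q x ∧ q x ≤ CQ) ∧ loss μ P π d₀ γ w (densityRatio p μ) q ≤ M} := by
    rintro q₁ ⟨h₁, l₁⟩ q₂ ⟨h₂, l₂⟩ c₁ c₂ hc₁ hc₂ hc
    have h₃ : ∀ x, 0 ≤ (c₁ • q₁ + c₂ • q₂) x ∧ (c₁ • q₁ + c₂ • q₂) x ≤ CQ := by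
      intro x
      simp only [Pi.add_apply, Pi.smul_apply, smul_eq_mul]
      obtain ⟨a₁, b₁⟩ := h₁ x
      obtain ⟨a₂, b₂⟩ := h₂ x
      refine ⟨by positivity, ?_⟩
      calc c₁ * q₁ x + c₂ * q₂ x ≤ c₁ * CQ + c₂ * CQ := by gcongr
        _ = CQ := by rw [← add_mul, hc, one_mul]
    refine ⟨h₃, ?_⟩
    rw [loss_densityRatio h0 h1 hp hb hw h₁] at l₁
    rw [loss_densityRatio h0 h1 hp hb hw h₂] at l₂
    rw [loss_densityRatio h0 h1 hp hb hw h₃, integral_policyValue_add_smul h₁ h₂]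
    have e : ∀ x, w x * ((c₁ • q₁ + c₂ • q₂) x - γ * transitionOp P π (c₁ • q₁ + c₂ • q₂) x) =
        c₁ * (w x * (q₁ x - γ * transitionOp P π q₁ x)) +
          c₂ * (w x * (q₂ x - γ * transitionOp P π q₂ x)) := by
      intro x
      rw [transitionOp, integral_policyValue_add_smul h₁ h₂]
      simp only [Pi.add_apply, Pi.smul_apply, smul_eq_mul, transitionOp]
      ring
    simp only [e]
    rw [integral_add
      ((integrable_of_abs_le (abs_mul_residual_le h0 h1 (abs_le_of_mem hw) h₁)).const_mul _)
      ((integrable_of_abs_le (abs_mul_residual_le h0 h1 (abs_le_of_mem hw) h₂)).const_mul _),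
      integral_const_mul, integral_const_mul]
    set x₁ := ∫ x, w x * (q₁ x - γ * transitionOp P π q₁ x) ∂p
    set x₂ := ∫ x, w x * (q₂ x - γ * transitionOp P π q₂ x) ∂p
    set y₁ := ∫ s, policyValue π q₁ s ∂d₀
    set y₂ := ∫ s, policyValue π q₂ s ∂d₀
    calc |c₁ * x₁ + c₂ * x₂ - (1 - γ) * (c₁ * y₁ + c₂ * y₂)|
        = |c₁ * (x₁ - (1 - γ) * y₁) + c₂ * (x₂ - (1 - γ) * y₂)| := by ring_nf
      _ ≤ c₁ * |x₁ - (1 - γ) * y₁| + c₂ * |x₂ - (1 - γ) * y₂| := by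
        refine (abs_add_le _ _).trans ?_
        rw [abs_mul, abs_mul, abs_of_nonneg hc₁, abs_of_nonneg hc₂]
      _ ≤ c₁ * M + c₂ * M := by gcongr
      _ = M := by rw [← add_mul, hc, one_mul]
  exact convexHull_min (fun q hq => show _ ∧ _ from ⟨hQ q hq, hM q hq⟩) hconv hq

/-- At the Q-function, the loss is the error of the importance-weighted return estimate. -/
lemma loss_qFunction (hr : ∀ x, |∫ r, r ∂(R x)| ≤ Rmax) (h0 : 0 ≤ γ) (h1 : γ < 1) (hp : p ≪ μ)
    {b : ℝ} (hb : ∀ x, densityRatio p μ x ≤ b) {w : S × A → ℝ} (hw : ∀ x, 0 ≤ w x ∧ w x ≤ CW)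
    (hQ : ∀ x, 0 ≤ qFunction P π R γ x ∧ qFunction P π R γ x ≤ CQ) :
    loss μ P π d₀ γ w (densityRatio p μ) (qFunction P π R γ) =
      |(∫ x, (∫ r, w x * r ∂(R x)) ∂p) - performance P π R d₀ γ| := by
  rw [loss_densityRatio h0 h1 hp hb hw hQ,
    performance_eq_integral_qFunction hr h0 h1 d₀ (abs_le_of_mem hQ)]
  congr 2
  refine integral_congr_ae (.of_forall fun x => ?_)
  change _ = ∫ r, w x * r ∂(R x)
  rw [integral_const_mul]
  exact congrArg (w x * ·) (sub_eq_of_eq_add <|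
    qFunction_bellman (P := P) (π := π) hr h0 h1 x)

/-- The policy value error is controlled by the best loss plus the suboptimality of `w'`. -/
lemma valueError_le_iInf_add (hr : ∀ x, |∫ r, r ∂(R x)| ≤ Rmax) (h0 : 0 ≤ γ) (h1 : γ < 1)
    (hp : p ≪ μ) {b : ℝ} (hb : ∀ x, densityRatio p μ x ≤ b) {W Q : Set (S × A → ℝ)}
    (hQ : ∀ q ∈ Q, ∀ x, 0 ≤ q x ∧ q x ≤ CQ) (hQπ : qFunction P π R γ ∈ convexHull ℝ Q)
    {w' : S × A → ℝ} (hw' : ∀ x, 0 ≤ w' x ∧ w' x ≤ CW) (hw'W : w' ∈ W) {e : ℝ}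
    (he : ∀ w ∈ W, ∀ q ∈ Q, loss μ P π d₀ γ w' (densityRatio p μ) q ≤
      (⨆ q : Q, loss μ P π d₀ γ w (densityRatio p μ) q) + e) :
    |(∫ x, (∫ r, w' x * r ∂(R x)) ∂p) - performance P π R d₀ γ| ≤
      (⨅ w : W, ⨆ q : Q, loss μ P π d₀ γ w (densityRatio p μ) q) + e := by
  have : Nonempty W := ⟨⟨w', hw'W⟩⟩
  rw [← sub_le_iff_le_add]
  refine le_ciInf fun w => ?_
  obtain ⟨h2, h3⟩ := loss_le_of_mem_convexHull h0 h1 hp hb hw' hQ (he w w.2) hQπ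
  rw [sub_le_iff_le_add, ← loss_qFunction hr h0 h1 hp hb hw' h2]
  exact h3

lemma loss_le_iSup (h0 : 0 ≤ γ) (h1 : γ < 1) (hp : p ≪ μ) {b : ℝ}
    (hb : ∀ x, densityRatio p μ x ≤ b) {w : S × A → ℝ} {Q : Set (S × A → ℝ)}
    (hw : ∀ x, 0 ≤ w x ∧ w x ≤ CW) (hQ : ∀ q ∈ Q, ∀ x, 0 ≤ q x ∧ q x ≤ CQ)
    {q : S × A → ℝ} (hq : q ∈ Q) :
    loss μ P π d₀ γ w (densityRatio p μ) q ≤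
      ⨆ q : Q, loss μ P π d₀ γ w (densityRatio p μ) q :=
  le_ciSup (f := fun q : Q => loss μ P π d₀ γ w (densityRatio p μ) q)
    ⟨CW * CQ + CQ, by
      rintro _ ⟨q, rfl⟩; exact loss_densityRatio_le h0 h1 hp hb hw (hQ q q.2)⟩ ⟨q, hq⟩

/-- Holds for every weight in `W`, with no sample involved; it handles the case of large statistical
error. -/
lemma valueError_le_crude (hr : ∀ x, |∫ r, r ∂(R x)| ≤ Rmax) (h0 : 0 ≤ γ) (h1 : γ < 1)
    (hp : p ≪ μ) {b : ℝ} (hb : ∀ x, densityRatio p μ x ≤ b) {W Q : Set (S × A → ℝ)}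
    (hW : ∀ w ∈ W, ∀ x, 0 ≤ w x ∧ w x ≤ CW)
    (hQ : ∀ q ∈ Q, ∀ x, 0 ≤ q x ∧ q x ≤ CQ) (hQπ : qFunction P π R γ ∈ convexHull ℝ Q)
    {w' : S × A → ℝ} (hw'W : w' ∈ W) :
    |(∫ x, (∫ r, w' x * r ∂(R x)) ∂p) - performance P π R d₀ γ| ≤
      (⨅ w : W, ⨆ q : Q, loss μ P π d₀ γ w (densityRatio p μ) q) + CW * CQ := by
  refine valueError_le_iInf_add hr h0 h1 hp hb hQ hQπ (hW w' hw'W) hw'W fun w hw q hq => ?_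
  exact (loss_densityRatio_le_add h0 h1 hp hb (hW w hw) (hW w' hw'W) (hQ q hq)).trans
    (add_le_add_left (loss_le_iSup h0 h1 hp hb (hW w hw) hQ hq) _)

/-- Error bound on the event where the empirical residuals are uniformly `D`-accurate and the
estimated ratio is `H`-accurate on the sample. -/
lemma valueError_le_of_deviation (hr : ∀ x, |∫ r, r ∂(R x)| ≤ Rmax) (h0 : 0 ≤ γ) (h1 : γ < 1)
    (hp : p ≪ μ) {B : ℝ} (hB : ∀ x, densityRatio p μ x ≤ B) {W Q : Set (S × A → ℝ)}
    (hW : ∀ w ∈ W, ∀ x, 0 ≤ w x ∧ w x ≤ CW)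
    (hQ : ∀ q ∈ Q, ∀ x, 0 ≤ q x ∧ q x ≤ CQ) (hQπ : qFunction P π R γ ∈ convexHull ℝ Q)
    {n : ℕ} {z : Fin n → (S × A) × S} {b : S × A → ℝ} {D H : ℝ}
    (hD : ∀ w ∈ W, ∀ q ∈ Q, |(1 / n : ℝ) * ∑ i, weightedResidual π γ w (densityRatio p μ) q (z i) -
      ∫ y, weightedResidual π γ w (densityRatio p μ) q y ∂(μ ⊗ₘ P)| ≤ D)
    (hH : (1 / n : ℝ) * ∑ i, |b (z i).1 - densityRatio p μ (z i).1| ≤ H)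
    {w' : S × A → ℝ} (hw'W : w' ∈ W)
    (hmin : IsMinOn (fun w => ⨆ q : Q, empiricalLoss z π d₀ γ w b q) W w') :
    |(∫ x, (∫ r, w' x * r ∂(R x)) ∂p) - performance P π R d₀ γ| ≤
      (⨅ w : W, ⨆ q : Q, loss μ P π d₀ γ w (densityRatio p μ) q) +
        (2 * D + 2 * (CW * CQ * H)) := by
  set β := densityRatio p μ
  have : Nonempty Q := by
    by_contra h
    rw [Set.nonempty_coe_sort, Set.not_nonempty_iff_eq_empty] at h
    simp [h] at hQπ
  have hsample : ∀ w ∈ W, ∀ q ∈ Q,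
      |(1 / n : ℝ) * ∑ i, weightedResidual π γ w b q (z i) -
        (1 / n : ℝ) * ∑ i, weightedResidual π γ w β q (z i)| ≤ CW * CQ * H := by
    intro w hw q hq
    rw [← mul_sub, ← Finset.sum_sub_distrib, abs_mul,
      abs_of_nonneg (by positivity : (0 : ℝ) ≤ 1 / n)]
    obtain ⟨x₀⟩ := μ.nonempty_of_neZero
    have hCW := (hW w hw x₀).1.trans (hW w hw x₀).2
    have hCQ := (hQ q hq x₀).1.trans (hQ q hq x₀).2
    refine le_trans ?_ (mul_le_mul_of_nonneg_left hH (by positivity))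
    rw [mul_left_comm, Finset.mul_sum]
    refine mul_le_mul_of_nonneg_left ((Finset.abs_sum_le_sum_abs _ _).trans
      (Finset.sum_le_sum fun i _ => ?_)) (by positivity)
    have e : weightedResidual π γ w b q (z i) - weightedResidual π γ w β q (z i) =
        w (z i).1 * (q (z i).1 - γ * policyValue π q (z i).2) * (b (z i).1 - β (z i).1) := by
      simp only [weightedResidual]; ring
    rw [e, abs_mul, abs_mul]
    have h2 := abs_le_of_mem (hW w hw) (z i).1
    have h3 := abs_sub_mul_le h0 h1 (hQ q hq (z i).1) (policyValue_mem (π := π) (hQ q hq) (z i).2)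
    gcongr
  -- The intermediate quantity is the empirical average with the exact ratio: `hsample` changes the
  -- ratio on the fixed sample, `hD` then changes the measure.
  have hdist : ∀ w ∈ W, ∀ q ∈ Q,
      |empiricalLoss z π d₀ γ w b q - loss μ P π d₀ γ w β q| ≤ D + CW * CQ * H := by
    intro w hw q hq
    refine (abs_abs_sub_abs_le _ _).trans ?_
    have h2 := hsample w hw q hq
    have h3 := hD w hw q hq
    rw [sub_sub_sub_cancel_right]
    refine (abs_sub_le _ ((1 / n : ℝ) * ∑ i, weightedResidual π γ w β q (z i)) _).trans ?_
    linarith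
  have hbdd : BddAbove (Set.range fun q : Q => empiricalLoss z π d₀ γ w' b q) := by
    refine ⟨CW * CQ + CQ + (D + CW * CQ * H), ?_⟩
    rintro _ ⟨q, rfl⟩
    have h2 := loss_densityRatio_le (P := P) (π := π) (d₀ := d₀) h0 h1 hp hB (hW w' hw'W) (hQ q q.2)
    have h3 := (abs_le.1 (hdist w' hw'W q q.2)).2
    simp only
    linarith
  refine valueError_le_iInf_add hr h0 h1 hp hB hQ hQπ (hW w' hw'W) hw'W fun w hw q hq => ?_
  have h2 := (abs_le.1 (hdist w' hw'W q hq)).1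
  have h3 := le_ciSup hbdd ⟨q, hq⟩
  have h4 : (⨆ q : Q, empiricalLoss z π d₀ γ w' b q) ≤ ⨆ q : Q, empiricalLoss z π d₀ γ w b q :=
    hmin hw
  have h5 : (⨆ q : Q, empiricalLoss z π d₀ γ w b q) ≤
      (⨆ q : Q, loss μ P π d₀ γ w β q) + (D + CW * CQ * H) := ciSup_le fun q' => by
    have h6 := (abs_le.1 (hdist w hw q' q'.2)).2
    have h7 := loss_le_iSup (P := P) (π := π) (d₀ := d₀) h0 h1 hp hB (hW w hw) hQ q'.2
    linarith
  simp only at h3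
  linarith

end Loss

/-! ### From NWJ excess risk to an `L¹` bound on the ratio estimate. -/

section RatioEstimate

variable {X : Type*} [Countable X] [MeasurableSpace X] [MeasurableSingletonClass X]

/-- Two-sided uniform deviation of empirical means over a bounded class. -/
lemma measure_exists_abs_deviation_le (P : Measure X) [IsProbabilityMeasure P] {n : ℕ}
    (hn : 0 < n) {G : Set (X → ℝ)} {B : ℝ} (hne : G.Nonempty) (hG : ∀ g ∈ G, ∀ x, |g x| ≤ B)
    {Ω : Type*} [MeasurableSpace Ω] {Pr : Measure Ω} [IsProbabilityMeasure Pr] {ξ : Fin n → Ω → X}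
    (hξ : ∀ k, HasLaw (ξ k) P Pr) (hind : iIndepFun ξ Pr) {s : ℝ} (hs : 0 ≤ s) :
    Pr {ω | ∃ g ∈ G, rademacher P n G + 4 * B * s <
      |(1 / n : ℝ) * ∑ k, g (ξ k ω) - ∫ y, g y ∂P|} ≤
      ENNReal.ofReal (Real.exp (-(2 * (n * s ^ 2)))) := by
  have : Nonempty G := hne.to_subtype
  have h := measure_exists_deviation_le P hn (ι := G × Bool)
    (g := fun i x => boolSign i.2 * (i.1 : X → ℝ) x) (B := B)
    (fun i x => by simpa [abs_mul] using hG i.1 i.1.2 x) hξ hind hs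
  have hle : oneSidedRademacher P n (fun (i : G × Bool) x => boolSign i.2 * (i.1 : X → ℝ) x) ≤
      rademacher P n G := oneSidedRademacher_le_rademacher P n hG fun i => by
    refine ⟨i.1, i.1.2, ?_⟩
    rcases i with ⟨g, _ | _⟩
    · right; ext x; simp
    · left; ext x; simp
  refine (measure_mono ?_).trans h
  rintro ω ⟨g, hg, hlt⟩
  rcases abs_cases ((1 / n : ℝ) * ∑ k, g (ξ k ω) - ∫ y, g y ∂P) with ⟨e, -⟩ | ⟨e, -⟩
  · refine ⟨(⟨g, hg⟩, true), ?_⟩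
    simp only [boolSign_true, one_mul]
    linarith
  · refine ⟨(⟨g, hg⟩, false), ?_⟩
    simp only [boolSign_false, neg_one_mul, Finset.sum_neg_distrib, integral_neg]
    linarith

/-- This is `log u ≤ u - 1` at `u = √a / √b`, multiplied by `2b`. Integrated, it says that the
excess risk dominates the squared Hellinger distance. -/
lemma sq_sqrt_sub_sqrt_le {a b : ℝ} (ha : 0 < a) (hb : 0 < b) :
    (√a - √b) ^ 2 ≤ a - b - b * (Real.log a - Real.log b) := by
  have ha' := Real.sqrt_pos.2 ha
  have hb' := Real.sqrt_pos.2 hb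
  have e1 : √a ^ 2 = a := Real.sq_sqrt ha.le
  have e2 : √b ^ 2 = b := Real.sq_sqrt hb.le
  have hl : Real.log a - Real.log b = 2 * Real.log (√a / √b) := by
    rw [Real.log_div ha'.ne' hb'.ne', Real.log_sqrt ha.le, Real.log_sqrt hb.le]
    ring
  have h2 := Real.log_le_sub_one_of_pos (div_pos ha' hb')
  have h3 : b * (√a / √b) = √a * √b := by
    calc b * (√a / √b) = √b ^ 2 * (√a / √b) := by rw [e2]
      _ = √a * √b := by field_simp
  have h4 := mul_le_mul_of_nonneg_left h2 hb.le
  rw [hl]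
  nlinarith

/-- Factor `a - b` through square roots, use `√a ≤ |√a - √b| + √b`, and split the cross term by
weighted AM-GM. The parameter `t` is later taken to be the square root of the excess risk. -/
lemma abs_sub_le_sqrt {a b t : ℝ} (ha : 0 < a) (hb : 0 < b) (ht : 0 < t) :
    |a - b| ≤ (1 + t⁻¹) * (√a - √b) ^ 2 + t * b := by
  have ha' := Real.sqrt_pos.2 ha
  have hb' := Real.sqrt_pos.2 hb
  have e1 : √a ^ 2 = a := Real.sq_sqrt ha.le
  have e2 : √b ^ 2 = b := Real.sq_sqrt hb.le
  set u := |√a - √b| with hu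
  have hu0 : 0 ≤ u := abs_nonneg _
  have hu2 : (√a - √b) ^ 2 = u ^ 2 := (sq_abs _).symm
  have h1 : |a - b| = u * (√a + √b) := by
    have e : a - b = (√a - √b) * (√a + √b) := by nlinarith
    rw [e, abs_mul, abs_of_pos (add_pos ha' hb')]
  have h2 : √a ≤ u + √b := by have := le_abs_self (√a - √b); linarith
  have h3 : 2 * (u * √b) ≤ t⁻¹ * u ^ 2 + t * b := by
    have h := mul_nonneg (inv_pos.2 ht).le (sq_nonneg (u - t * √b))
    have e : t⁻¹ * (u - t * √b) ^ 2 = t⁻¹ * u ^ 2 - 2 * (u * √b) + t * √b ^ 2 := by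
      field_simp
      ring
    rw [e, e2] at h
    linarith
  rw [h1, hu2]
  nlinarith

/-- A density-ratio candidate with small excess Nguyen–Wainwright–Jordan risk is close in `L¹`. -/
lemma integral_abs_sub_densityRatio_le {p μ : Measure X} [IsProbabilityMeasure p]
    [IsProbabilityMeasure μ] (hp : p ≪ μ) {f f₀ : X → ℝ} {c C : ℝ} (hc : 0 < c)
    (hf : ∀ x, c ≤ f x ∧ f x ≤ C) (hf₀ : ∀ x, c ≤ f₀ x ∧ f₀ x ≤ C)
    (hβ : f₀ =ᵐ[μ] densityRatio p μ) {E : ℝ} (hE : 0 < E)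
    (hle : (∫ x, f x ∂μ - ∫ x, Real.log (f x) ∂p) -
      (∫ x, f₀ x ∂μ - ∫ x, Real.log (f₀ x) ∂p) ≤ E) :
    ∫ x, |f x - densityRatio p μ x| ∂μ ≤ E + 2 * √E := by
  have hpos : ∀ x, 0 < f x := fun x => hc.trans_le (hf x).1
  have hpos₀ : ∀ x, 0 < f₀ x := fun x => hc.trans_le (hf₀ x).1
  have hlog : ∀ {g : X → ℝ}, (∀ x, c ≤ g x ∧ g x ≤ C) → ∀ x, |Real.log (g x)| ≤
      |Real.log c| + |Real.log C| := by
    intro g hg x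
    have h1 := Real.log_le_log hc (hg x).1
    have h2 := Real.log_le_log (hc.trans_le (hg x).1) (hg x).2
    refine abs_le.2 ⟨?_, ?_⟩
    · linarith [neg_abs_le (Real.log c), abs_nonneg (Real.log C)]
    · linarith [le_abs_self (Real.log C), abs_nonneg (Real.log c)]
  have hfi : Integrable f μ := integrable_of_abs_le fun x =>
    abs_le_of_mem (fun x => ⟨(hpos x).le, (hf x).2⟩) x
  have hfi₀ : Integrable f₀ μ := integrable_of_abs_le fun x =>
    abs_le_of_mem (fun x => ⟨(hpos₀ x).le, (hf₀ x).2⟩) x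
  -- `f₀` is a version of the density of `p`, so log terms under `p` become integrals against `μ`;
  -- in particular `f₀` has `μ`-integral one.
  have hchange : ∀ g : X → ℝ, ∫ x, g x ∂p = ∫ x, f₀ x * g x ∂μ := fun g => by
    rw [integral_eq_integral_densityRatio_mul hp]
    exact integral_congr_ae (hβ.mono fun x hx => by simp only [hx])
  have hone : ∫ x, f₀ x ∂μ = 1 := by
    have := hchange fun _ => 1
    simpa using this.symm
  have hli : Integrable (fun x => f₀ x * (Real.log (f x) - Real.log (f₀ x))) μ := by
    refine integrable_of_abs_le (B := C * (2 * (|Real.log c| + |Real.log C|))) fun x => ?_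
    rw [abs_mul, abs_of_pos (hpos₀ x)]
    refine mul_le_mul (hf₀ x).2 ((abs_sub _ _).trans ?_) (abs_nonneg _)
      ((hpos₀ x).le.trans (hf₀ x).2)
    linarith [hlog hf x, hlog hf₀ x]
  have hHi : Integrable (fun x => (√(f x) - √(f₀ x)) ^ 2) μ := by
    refine integrable_of_abs_le (B := C + C) fun x => ?_
    rw [abs_of_nonneg (sq_nonneg _), sub_sq, Real.sq_sqrt (hpos x).le, Real.sq_sqrt (hpos₀ x).le]
    have := mul_nonneg (Real.sqrt_nonneg (f x)) (Real.sqrt_nonneg (f₀ x))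
    linarith [(hf x).2, (hf₀ x).2]
  have hH : ∫ x, (√(f x) - √(f₀ x)) ^ 2 ∂μ ≤ E := by
    refine le_trans ((integral_mono hHi ((hfi.sub hfi₀).sub hli)
      fun x => sq_sqrt_sub_sqrt_le (hpos x) (hpos₀ x)).trans (le_of_eq ?_)) hle
    rw [integral_sub' (hfi.sub hfi₀) hli, integral_sub' hfi hfi₀,
      ← hchange fun x => Real.log (f x) - Real.log (f₀ x),
      integral_sub (integrable_of_abs_le (hlog hf)) (integrable_of_abs_le (hlog hf₀))]
    ring
  have hs := Real.sqrt_pos.2 hE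
  have hss : √E * √E = E := Real.mul_self_sqrt hE.le
  calc ∫ x, |f x - densityRatio p μ x| ∂μ = ∫ x, |f x - f₀ x| ∂μ :=
        integral_congr_ae (hβ.mono fun x hx => by simp only [hx])
    _ ≤ ∫ x, ((1 + (√E)⁻¹) * (√(f x) - √(f₀ x)) ^ 2 + √E * f₀ x) ∂μ :=
        integral_mono (hfi.sub hfi₀).abs ((hHi.const_mul _).add (hfi₀.const_mul _))
          fun x => abs_sub_le_sqrt (hpos x) (hpos₀ x) hs
    _ = (1 + (√E)⁻¹) * ∫ x, (√(f x) - √(f₀ x)) ^ 2 ∂μ + √E := by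
        rw [integral_add (hHi.const_mul _) (hfi₀.const_mul _), integral_const_mul,
          integral_const_mul, hone, mul_one]
    _ ≤ (1 + (√E)⁻¹) * E + √E := by gcongr
    _ = E + 2 * √E := by
        field_simp
        nlinarith

variable {F : Set (X → ℝ)} {c C CF : ℝ}

lemma abs_log_le_max {x : ℝ} (hc : 0 < c) (h : c ≤ x ∧ x ≤ C) :
    |Real.log x| ≤ max (Real.log C) (-Real.log c) :=
  abs_le'.2 ⟨(Real.log_le_log (hc.trans_le h.1) h.2).trans (le_max_left _ _),
    (neg_le_neg (Real.log_le_log hc h.1)).trans (le_max_right _ _)⟩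

lemma abs_le_of_mem_ratioLossClass (hc : 0 < c) (hF : ∀ f ∈ F, ∀ x, c ≤ f x ∧ f x ≤ C)
    (hCF : CF = C + max (Real.log C) (-Real.log c)) :
    ∀ g ∈ ratioLossClass F, ∀ z, |g z| ≤ CF := by
  rintro _ ⟨f, hf, rfl⟩ z
  rw [hCF]
  refine (abs_sub _ _).trans (add_le_add ?_ (abs_log_le_max hc (hF f hf z.2)))
  rw [abs_of_pos (hc.trans_le (hF f hf z.1).1)]
  exact (hF f hf z.1).2

/-- The empirical maximizer of the NWJ objective has excess risk at most twice the deviation. -/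
lemma excessRisk_le_of_deviation {p μ : Measure X} [IsProbabilityMeasure p]
    [IsProbabilityMeasure μ] (hc : 0 < c) (hF : ∀ f ∈ F, ∀ x, c ≤ f x ∧ f x ≤ C) {n : ℕ}
    {x y : Fin n → X} {r : ℝ}
    (hdev : ∀ g ∈ ratioLossClass F,
      |(1 / n : ℝ) * ∑ k, g (y k, x k) - ∫ z, g z ∂(μ.prod p)| ≤ r)
    {f f₀ : X → ℝ} (hf : f ∈ F) (hf₀ : f₀ ∈ F) (hmax : IsMaxOn (nwjObjective x y) F f) :
    (∫ x, f x ∂μ - ∫ x, Real.log (f x) ∂p) - (∫ x, f₀ x ∂μ - ∫ x, Real.log (f₀ x) ∂p) ≤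
      2 * r := by
  have key : ∀ g ∈ F, |-nwjObjective x y g - (∫ x, g x ∂μ - ∫ x, Real.log (g x) ∂p)| ≤ r := by
    intro g hg
    have h := hdev _ ⟨g, hg, rfl⟩
    have e : ∫ z : X × X, (g z.1 - Real.log (g z.2)) ∂(μ.prod p) =
        ∫ x, g x ∂μ - ∫ x, Real.log (g x) ∂p := by
      rw [integral_sub (f := fun z : X × X => g z.1) (g := fun z => Real.log (g z.2))
        (integrable_of_abs_le (B := C) fun z => abs_le_of_mem
          (fun x => ⟨hc.le.trans (hF g hg x).1, (hF g hg x).2⟩) z.1)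
        (integrable_of_abs_le fun z => abs_log_le_max hc (hF g hg z.2)),
        integral_comp_measurePreserving measurePreserving_fst g,
        integral_comp_measurePreserving measurePreserving_snd fun x => Real.log (g x)]
    simp only at h
    rw [e, Finset.sum_sub_distrib] at h
    rw [nwjObjective, neg_sub, ← mul_sub]
    exact h
  have h1 := abs_le.1 (key f hf)
  have h2 := abs_le.1 (key f₀ hf₀)
  have h3 : nwjObjective x y f₀ ≤ nwjObjective x y f := hmax hf₀
  linarith [h1.1, h2.2]

/-- The deviation of `|f - β|` is controlled by the complexity of the ratio loss class. -/
lemma oneSidedRademacher_abs_sub_le {p μ : Measure X} [IsProbabilityMeasure p]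
    [IsProbabilityMeasure μ] (hne : F.Nonempty) (hc : 0 < c)
    (hF : ∀ f ∈ F, ∀ x, c ≤ f x ∧ f x ≤ C)
    (hCF : CF = C + max (Real.log C) (-Real.log c)) {β : X → ℝ} (hβ : ∀ x, 0 ≤ β x ∧ β x ≤ C)
    {n : ℕ} (hn : 0 < n) :
    oneSidedRademacher μ n (fun (f : F) x => |(f : X → ℝ) x - β x|) ≤
      rademacher (μ.prod p) n (ratioLossClass F) +
        2 * max (Real.log C) (-Real.log c) / √n := by
  have : Nonempty F := hne.to_subtype
  refine (oneSidedRademacher_le_of_contraction μ n (a := fun (f : F) x => (f : X → ℝ) x) (B := C)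
    (fun f x => ?_) (fun f x => ?_) fun f g x => ?_).trans
    ((oneSidedRademacher_le_prod μ p hn (B := C) (f := fun (f : F) x => (f : X → ℝ) x)
      (l := fun (f : F) x => Real.log ((f : X → ℝ) x)) (fun f x => ?_)
      fun f x => abs_log_le_max hc (hF f f.2 x)).trans (add_le_add_left ?_ _))
  · rw [abs_abs]
    exact abs_le.2 ⟨by linarith [hF f f.2 x, hβ x], by linarith [hF f f.2 x, hβ x]⟩
  · exact abs_le_of_mem (fun x => ⟨hc.le.trans (hF f f.2 x).1, (hF f f.2 x).2⟩) x
  · refine (abs_abs_sub_abs_le _ _).trans (le_of_eq ?_)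
    rw [sub_sub_sub_cancel_right]
  · exact abs_le_of_mem (fun x => ⟨hc.le.trans (hF f f.2 x).1, (hF f f.2 x).2⟩) x
  · exact oneSidedRademacher_le_rademacher _ n (abs_le_of_mem_ratioLossClass hc hF hCF)
      fun f => ⟨_, ⟨f, f.2, rfl⟩, Or.inl rfl⟩

end RatioEstimate

/-! ### Numerical constants. -/

/-- The exponential equals `(δ / 2) ^ 4`, small enough to leave room for three bad events. -/
lemma exp_neg_deviation_le {δ : ℝ} (hδ : 0 < δ) (hδ1 : δ < 1) {n : ℕ} (hn : 0 < n) :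
    Real.exp (-(2 * (n * √(2 * Real.log (2 / δ) / n) ^ 2))) ≤ δ / 3 := by
  have hn' : (0 : ℝ) < n := by exact_mod_cast hn
  have hL : 0 < Real.log (2 / δ) := Real.log_pos (by rw [lt_div_iff₀ hδ]; linarith)
  rw [Real.sq_sqrt (by positivity)]
  have e : -(2 * (n * (2 * Real.log (2 / δ) / n))) = (4 : ℕ) * -Real.log (2 / δ) := by
    field_simp
    norm_num
  rw [e, Real.exp_nat_mul, Real.exp_neg, Real.exp_log (by positivity), inv_div]
  have h3 : δ ^ 3 ≤ 1 := pow_le_one₀ hδ.le hδ1.le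
  nlinarith [mul_le_mul_of_nonneg_left h3 hδ.le]

/-- Lets the `1 / √n` cost of restoring the logarithm be absorbed into `s`; it holds because `2 log
2 > 1`. -/
lemma one_div_sqrt_le_deviation {δ : ℝ} (hδ : 0 < δ) (hδ1 : δ < 1) {n : ℕ} (hn : 0 < n) :
    1 / √(n : ℝ) ≤ √(2 * Real.log (2 / δ) / n) := by
  have hn' : (0 : ℝ) < n := by exact_mod_cast hn
  have hL : Real.log 2 ≤ Real.log (2 / δ) :=
    Real.log_le_log two_pos (by rw [le_div_iff₀ hδ]; linarith)
  rw [← Real.sqrt_one, ← Real.sqrt_div zero_le_one]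
  refine Real.sqrt_le_sqrt (div_le_div_of_nonneg_right ?_ hn'.le)
  linarith [Real.log_two_gt_d9]

lemma le_max_log {c C : ℝ} (hc : 0 < c) (hcC : c ≤ C) :
    0 ≤ max (Real.log C) (-Real.log c) := by
  rcases le_total 1 C with h | h
  · exact (Real.log_nonneg h).trans (le_max_left _ _)
  · exact (neg_nonneg.2 (Real.log_nonpos hc.le (hcC.trans h))).trans (le_max_right _ _)

/-- Collecting the deviation terms into the square-root term. -/
lemma deviation_terms_le {R₁ R₂ CF C M K s T b : ℝ} (hR₁ : 0 ≤ R₁) (hs : 0 ≤ s) (hM : 0 ≤ M)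
    (hC : 0 ≤ C) (hCF : CF = C + M) (hK : 0 ≤ K) (hT : T = 4 * R₁ + CF * s) (hT1 : T ≤ 1)
    (hb : 1 ≤ b) :
    2 * (R₂ + 4 * (K * C) * s) +
        2 * (K * (8 * T + 2 * √(8 * T) + (R₁ + 2 * M * s) + 4 * C * s)) ≤
      2 * K * (24 * √(b * T)) + 2 * R₂ := by
  have hCs : 0 ≤ C * s := mul_nonneg hC hs
  have hMs : 0 ≤ M * s := mul_nonneg hM hs
  have hT0 : 0 ≤ T := by rw [hT, hCF, add_mul]; positivity
  have hTs : T ≤ √T := by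
    rw [Real.le_sqrt hT0 hT0]
    nlinarith
  have h8 : √(8 * T) ≤ 3 * √T := by
    rw [Real.sqrt_mul (by norm_num)]
    gcongr
    rw [Real.sqrt_le_left (by norm_num)]
    norm_num
  have hbT : √T ≤ √(b * T) := Real.sqrt_le_sqrt (by nlinarith)
  have h1 : R₁ + (C * s + M * s) ≤ T := by rw [hT, hCF]; linarith
  -- The terms in `R₁`, `C * s`, `M * s` total at most `8 * T`, and `2 * √(8 * T) ≤ 6 * √T`, so at
  -- most `22 * √T` is used.
  have h2 : 4 * (C * s) + (8 * T + 2 * √(8 * T) + (R₁ + 2 * M * s) + 4 * C * s) ≤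
      24 * √(b * T) := by
    linarith
  have h3 := mul_le_mul_of_nonneg_left h2 hK
  linarith

end OffEnv

/-! ### Assembly of the bound. -/

theorem theorem1 :
    ∃ c : ℝ, 0 < c ∧
      ∀ (S A : Type*)
        [Countable S] [MeasurableSpace S] [MeasurableSingletonClass S]
        [Countable A] [MeasurableSpace A] [MeasurableSingletonClass A]
        -- the two environments, the policy, the data distribution
        (Ptr Pte : Kernel (S × A) S) [IsMarkovKernel Ptr] [IsMarkovKernel Pte]
        (R : Kernel (S × A) ℝ) [IsMarkovKernel R] (Rmax : ℝ)
        (_ : ∀ x, ∀ᵐ r ∂(R x), r ∈ Set.Icc 0 Rmax)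
        (π : Kernel S A) [IsMarkovKernel π]
        (d₀ : Measure S) [IsProbabilityMeasure d₀]
        (γ : ℝ) (_ : 0 ≤ γ) (_ : γ < 1)
        (μ : Measure (S × A)) [IsProbabilityMeasure μ]
        (dtr : Measure (S × A)) (_ : dtr = OffEnv.occupancy Ptr π d₀ γ)
        (β : S × A → ℝ) (_ : β = OffEnv.densityRatio dtr μ)
        -- the bounded function classes
        (F W Q : Set (S × A → ℝ)) (CFmin CFmax CF CW CQ : ℝ)
        (_ : 0 < CFmin)
        (_ : ∀ f ∈ F, ∀ x, CFmin ≤ f x ∧ f x ≤ CFmax)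
        (_ : CF = CFmax + max (Real.log CFmax) (-Real.log CFmin))
        (_ : ∀ w ∈ W, ∀ x, 0 ≤ w x ∧ w x ≤ CW)
        (_ : ∀ q ∈ Q, ∀ x, 0 ≤ q x ∧ q x ≤ CQ)
        -- coverage and realizability of the ratio, and the Q-function in the convex hull
        (_ : dtr ≪ μ)
        (_ : ∃ f ∈ F, f =ᵐ[μ] β)
        (_ : OffEnv.qFunction Pte π R γ ∈ convexHull ℝ Q)
        -- the samples
        (n : ℕ) (_ : 0 < n)
        (Ω : Type*) [MeasurableSpace Ω] (Pr : Measure Ω) [IsProbabilityMeasure Pr]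
        (X Y : Fin n → Ω → S × A) (Z : Fin n → Ω → (S × A) × S)
        (_ : ∀ i, HasLaw (fun ω => (X i ω, Y i ω)) (dtr.prod μ) Pr)
        (_ : iIndepFun (fun i ω => (X i ω, Y i ω)) Pr)
        (_ : ∀ i, HasLaw (Z i) (μ ⊗ₘ Pte) Pr)
        (_ : iIndepFun Z Pr)
        -- the two estimation steps
        (βHat wHat : Ω → S × A → ℝ)
        (_ : ∀ᵐ ω ∂Pr, βHat ω ∈ F ∧
          IsMaxOn (OffEnv.nwjObjective (fun i => X i ω) (fun i => Y i ω)) F (βHat ω))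
        (_ : ∀ᵐ ω ∂Pr, wHat ω ∈ W ∧
          IsMinOn (fun w => ⨆ q : Q,
            OffEnv.empiricalLoss (fun i => Z i ω) π d₀ γ w (βHat ω) q) W (wHat ω))
        (δ : ℝ) (_ : 0 < δ) (_ : δ < 1),
        -- the bound fails with (outer) probability at most `δ`
        Pr {ω | ¬ (|(∫ x, (∫ r, wHat ω x * r ∂(R x)) ∂dtr) - OffEnv.performance Pte π R d₀ γ| ≤
          (⨅ w : W, ⨆ q : Q, OffEnv.loss μ Pte π d₀ γ w β q)
          + 2 * CW * CQ * (c * √((⨆ x, β x) *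
              (4 * OffEnv.rademacher (μ.prod dtr) n (OffEnv.ratioLossClass F)
                + CF * √(2 * Real.log (2 / δ) / n))))
          + 2 * OffEnv.rademacher (μ ⊗ₘ Pte) n (OffEnv.residualClass π γ W β Q)
          + CQ * CW * √(Real.log (2 / δ) / (2 * n)))} ≤ ENNReal.ofReal δ := by
  refine ⟨24, by norm_num, ?_⟩
  intro S A _ _ _ _ _ _ Ptr Pte _ _ R _ Rmax hR π _ d₀ _ γ h0 h1 μ _ dtr hdtr β hβ F W Q CFmin CFmax
    CF CW CQ hc hF hCF hW hQ hp hreal hQπ n hn Ω _ Pr _ X Y Z hXY hXYi hZ hZi βHat wHat hβHat hwHat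
    δ hδ hδ1
  have hn' : (0 : ℝ) < n := by exact_mod_cast hn
  obtain ⟨f₀, hf₀F, hf₀⟩ := hreal
  have : SFinite dtr := by
    rw [hdtr]
    unfold OffEnv.occupancy
    infer_instance
  -- Total mass one is read off from the law of a sample pair, which avoids summing the occupancy
  -- series.
  have : IsProbabilityMeasure dtr := by
    have h := ((hXY ⟨0, hn⟩).isProbabilityMeasure_iff.1 inferInstance).measure_univ
    rw [← Set.univ_prod_univ, Measure.prod_prod, measure_univ (μ := μ), mul_one] at h
    exact ⟨h⟩
  subst hβ
  obtain ⟨x₀⟩ := μ.nonempty_of_neZero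
  have hCm : CFmin ≤ CFmax := (hF f₀ hf₀F x₀).1.trans (hF f₀ hf₀F x₀).2
  have hC : 0 < CFmax := hc.trans_le hCm
  have hM := OffEnv.le_max_log hc hCm
  have hβC : ∀ x, 0 ≤ OffEnv.densityRatio dtr μ x ∧ OffEnv.densityRatio dtr μ x ≤ CFmax := fun x =>
    ⟨OffEnv.densityRatio_nonneg x,
      OffEnv.densityRatio_le_of_ae_eq hf₀ hC.le (fun x => (hF f₀ hf₀F x).2) x⟩
  have hr : ∀ x, |∫ r, r ∂(R x)| ≤ Rmax := by
    intro x
    have h := norm_integral_le_of_norm_le_const (μ := R x) (f := fun r => r) (C := Rmax)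
      ((hR x).mono fun r hr => by rw [Real.norm_eq_abs, abs_of_nonneg hr.1]; exact hr.2)
    simpa using h
  -- `β` has `μ`-integral one, so its supremum is at least one.
  have hb1 : 1 ≤ ⨆ x, OffEnv.densityRatio dtr μ x := by
    have hbdd : BddAbove (Set.range (OffEnv.densityRatio dtr μ)) :=
      ⟨CFmax, by rintro _ ⟨x, rfl⟩; exact (hβC x).2⟩
    have h := OffEnv.integral_eq_integral_densityRatio_mul hp fun _ => 1
    simp only [integral_const, probReal_univ, one_smul, mul_one] at h
    rw [h]
    exact (OffEnv.integral_mem_Icc μ fun x => ⟨(hβC x).1, le_ciSup hbdd x⟩).2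
  have hQne : Q.Nonempty := by
    by_contra h
    rw [Set.not_nonempty_iff_eq_empty] at h
    simp [h] at hQπ
  obtain ⟨q₀, hq₀⟩ := hQne
  have hCQ : 0 ≤ CQ := (hQ q₀ hq₀ x₀).1.trans (hQ q₀ hq₀ x₀).2
  have hWne : W.Nonempty := by
    obtain ⟨ω, hω⟩ := hwHat.exists
    exact ⟨_, hω.1⟩
  obtain ⟨w₀, hw₀⟩ := hWne
  have hCW : 0 ≤ CW := (hW w₀ hw₀ x₀).1.trans (hW w₀ hw₀ x₀).2
  set s : ℝ := √(2 * Real.log (2 / δ) / n) with hs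
  have hs0 : 0 ≤ s := Real.sqrt_nonneg _
  have hs1 : 1 / √(n : ℝ) ≤ s := OffEnv.one_div_sqrt_le_deviation hδ hδ1 hn
  have hspos : 0 < s := lt_of_lt_of_le (by positivity) hs1
  have hprob : ENNReal.ofReal (Real.exp (-(2 * (n * s ^ 2)))) ≤ ENNReal.ofReal (δ / 3) :=
    ENNReal.ofReal_le_ofReal (OffEnv.exp_neg_deviation_le hδ hδ1 hn)
  set R₁ := OffEnv.rademacher (μ.prod dtr) n (OffEnv.ratioLossClass F) with hR₁
  set R₂ := OffEnv.rademacher (μ ⊗ₘ Pte) n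
    (OffEnv.residualClass π γ W (OffEnv.densityRatio dtr μ) Q) with hR₂
  have hR₁0 : 0 ≤ R₁ := OffEnv.rademacher_nonneg _ _ _
  have hR₂0 : 0 ≤ R₂ := OffEnv.rademacher_nonneg _ _ _
  have hYX : ∀ i, HasLaw (fun ω => (Y i ω, X i ω)) (μ.prod dtr) Pr := fun i =>
    (Measure.measurePreserving_swap (μ := dtr) (ν := μ)).hasLaw.comp (hXY i)
  have hYXi : iIndepFun (fun i ω => (Y i ω, X i ω)) Pr :=
    hXYi.comp (fun _ => Prod.swap) fun _ => measurable_swap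
  have hZ1 : ∀ i, HasLaw (fun ω => (Z i ω).1) μ Pr := fun i => by
    have h : HasLaw Prod.fst μ (μ ⊗ₘ Pte) := ⟨measurable_fst.aemeasurable, Measure.fst_compProd μ Pte⟩
    exact h.comp (hZ i)
  have hZ1i : iIndepFun (fun i ω => (Z i ω).1) Pr :=
    hZi.comp (fun _ => Prod.fst) fun _ => measurable_fst
  have hresB : ∀ g ∈ OffEnv.residualClass π γ W (OffEnv.densityRatio dtr μ) Q, ∀ z,
      |g z| ≤ CW * CFmax * CQ := by
    rintro _ ⟨w, hw, q, hq, rfl⟩ z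
    exact OffEnv.abs_weightedResidual_le h0 h1 (hW w hw) hβC (hQ q hq) z
  -- Three bad events: ratio losses on the pairs `(y, x)`, residuals on `z`, and `|f - β|` on the
  -- first components of `z`. Only a union bound joins them, so `z` may depend on `x` and `y`.
  have P1 := (OffEnv.measure_exists_abs_deviation_le (μ.prod dtr) hn
    (Set.Nonempty.image _ ⟨f₀, hf₀F⟩)
    (OffEnv.abs_le_of_mem_ratioLossClass hc hF hCF) hYX hYXi hs0).trans hprob
  have P2 := (OffEnv.measure_exists_abs_deviation_le (μ ⊗ₘ Pte) hn
    (Set.Nonempty.image2 ⟨w₀, hw₀⟩ ⟨q₀, hq₀⟩)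
    hresB hZ hZi hs0).trans hprob
  have : Nonempty F := ⟨⟨f₀, hf₀F⟩⟩
  have P3 := (OffEnv.measure_exists_deviation_le μ hn (B := CFmax)
    (g := fun (f : F) x => |(f : S × A → ℝ) x - OffEnv.densityRatio dtr μ x|) (fun f x => by
      rw [abs_abs]
      exact abs_le.2 ⟨by linarith [hF f f.2 x, hβC x], by linarith [hF f f.2 x, hβC x]⟩)
    hZ1 hZ1i hs0).trans hprob
  have h3δ : ENNReal.ofReal (δ / 3) + ENNReal.ofReal (δ / 3) + ENNReal.ofReal (δ / 3) =
      ENNReal.ofReal δ := by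
    rw [← ENNReal.ofReal_add (by positivity) (by positivity),
      ← ENNReal.ofReal_add (by positivity) (by positivity)]
    ring_nf
  rw [← h3δ]
  refine le_trans (measure_mono_ae ?_) ((measure_union_le _ _).trans (add_le_add
    ((measure_union_le _ _).trans (add_le_add P1 P2)) P3))
  filter_upwards [hβHat, hwHat] with ω hβω hwω hbad
  by_contra hgood
  refine hbad ?_
  change ω ∉ (_ ∪ _ ∪ _ : Set Ω) at hgood
  simp only [Set.mem_union, not_or] at hgood
  obtain ⟨⟨g1, g2⟩, g3⟩ := hgood
  replace g1 : ∀ g ∈ OffEnv.ratioLossClass F,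
      |(1 / n : ℝ) * ∑ k, g (Y k ω, X k ω) - ∫ z, g z ∂(μ.prod dtr)| ≤ R₁ + 4 * CF * s :=
    fun g hg => not_lt.1 fun h => g1 ⟨g, hg, h⟩
  replace g2 : ∀ w ∈ W, ∀ q ∈ Q,
      |(1 / n : ℝ) * ∑ k, OffEnv.weightedResidual π γ w (OffEnv.densityRatio dtr μ) q (Z k ω) -
        ∫ z, OffEnv.weightedResidual π γ w (OffEnv.densityRatio dtr μ) q z ∂(μ ⊗ₘ Pte)| ≤
        R₂ + 4 * (CW * CFmax * CQ) * s :=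
    fun w hw q hq => not_lt.1 fun h => g2 ⟨_, ⟨w, hw, q, hq, rfl⟩, h⟩
  -- The bound is uniform over `F`, so it may be evaluated at the random `βHat ω`, without
  -- independence or measurability of the estimator.
  have g3' : (1 / n : ℝ) * ∑ k, |βHat ω (Z k ω).1 - OffEnv.densityRatio dtr μ (Z k ω).1| -
      ∫ x, |βHat ω x - OffEnv.densityRatio dtr μ x| ∂μ ≤ _ :=
    not_lt.1 fun h => g3 ⟨⟨βHat ω, hβω.1⟩, h⟩
  set T : ℝ := 4 * R₁ + CF * s with hT
  have hCF0 : 0 < CF := by rw [hCF]; positivity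
  have hCFs : 0 < CF * s := mul_pos hCF0 hspos
  have hTpos : 0 < T := by positivity
  -- Only the sign of this term matters; the residual concentration term is absorbed into the square
  -- root.
  have hlast : 0 ≤ CQ * CW * √(Real.log (2 / δ) / (2 * n)) := by positivity
  -- For `T ≤ 1` linear terms are dominated by `√T`; for `T > 1` the square root alone exceeds one
  -- and beats the crude error `CW * CQ`.
  rcases le_or_gt T 1 with hT1 | hT1
  · have hL1 : ∫ x, |βHat ω x - OffEnv.densityRatio dtr μ x| ∂μ ≤ 8 * T + 2 * √(8 * T) :=
      OffEnv.integral_abs_sub_densityRatio_le hp hc (hF _ hβω.1) (hF f₀ hf₀F) hf₀ (by positivity)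
        ((OffEnv.excessRisk_le_of_deviation hc hF g1 hβω.1 hf₀F hβω.2).trans (by
          rw [hT]; linarith))
    have hR₃ := OffEnv.oneSidedRademacher_abs_sub_le (p := dtr) (μ := μ) ⟨f₀, hf₀F⟩ hc hF hCF hβC hn
    have hMs : 2 * max (Real.log CFmax) (-Real.log CFmin) / √(n : ℝ) ≤
        2 * max (Real.log CFmax) (-Real.log CFmin) * s := by
      rw [div_eq_mul_one_div]
      gcongr
    have hH : (1 / n : ℝ) * ∑ k, |βHat ω (Z k ω).1 - OffEnv.densityRatio dtr μ (Z k ω).1| ≤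
        8 * T + 2 * √(8 * T) + (R₁ + 2 * max (Real.log CFmax) (-Real.log CFmin) * s) +
          4 * CFmax * s := by
      linarith
    have hval := OffEnv.valueError_le_of_deviation (d₀ := d₀) hr h0 h1 hp (fun x => (hβC x).2) hW hQ
      hQπ g2 hH hwω.1 hwω.2
    have hfin := OffEnv.deviation_terms_le (R₂ := R₂) (K := CW * CQ) hR₁0 hs0 hM hC.le hCF
      (mul_nonneg hCW hCQ) hT hT1 hb1
    have e : CW * CQ * CFmax = CW * CFmax * CQ := by ring
    rw [e] at hfin
    linarith
  · have hval := OffEnv.valueError_le_crude (d₀ := d₀) hr h0 h1 hp (fun x => (hβC x).2) hW hQ hQπ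
      hwω.1
    have hbT : 1 ≤ √((⨆ x, OffEnv.densityRatio dtr μ x) * T) := by
      rw [Real.one_le_sqrt]
      nlinarith
    have hK := mul_nonneg hCW hCQ
    have := mul_le_mul_of_nonneg_left hbT hK
    nlinarith
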